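/- Let $\mathbf{Top}_2$ be the category of bipointed topological spaces: objects are triples $(X,a,b)$ with $X$ a topological space and $a,b\in X$; morphisms $(X,a,b)\to(X',a',b')$ are continuous maps $f:X\to X'$ with $f(a)=a'$, $f(b)=b'$. Let $n\geq 0$. For $(X,a,b)$ in $\mathbf{Top}_2$, let $\pi_1(a,b)$ be the set of homotopy classes (with fixed endpoints) of paths from $a$ to $b$, let $\pi_1(a)=\pi_1(a,a)$ be the fundamental group, acting on $\pi_1(a,b)$ on the right by $(\gamma,\alpha)\mapsto\gamma\cdot\alpha$ = the class of "$\alpha$ followed by $\gamma$", let $\mathbb Z\pi_1(a,b)$ be the free abelian group on $\pi_1(a,b)$, a right module over the group ring $\mathbb Z\pi_1(a)$, and let $(\mathbb Z\pi_1(a))_+$ be the augmentation ideal. Put $$\mathbf F_n(X,a,b)=\mathbb Z\pi_1(a,b)\big/\mathbb Z\pi_1(a,b)\,(\mathbb Z\pi_1(a))_+^{\,n+1}.$$ Put also $$\mathbf H_n(X,a,b)=\mathrm H_n\bigl(X^n,Y^{(n)}_{ab}\bigr),\qquad Y^{(n)}_{ab}=\bigcup_{i=0}^n\{(x_1,\ldots,x_n)\in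 X^n\mid x_i=x_{i+1}\},\quad x_0:=a,\ x_{n+1}:=b,$$ where $\mathrm H_n(-,-)$ is relative singular homology with coefficients in $\mathbb Z$. Both $\mathbf F_n$ and $\mathbf H_n$ are covariant functors from $\mathbf{Top}_2$ to the category of abelian groups, a morphism $f$ acting by composition of paths with $f$, respectively by the map of pairs induced by $f^n:X^n\to X'^n$. Let $\Delta^n=\{(t_1,\ldots,t_n)\in\mathbb R^n\mid 0\le t_1\le\cdots\le t_n\le 1\}$. For a path $\tilde\gamma:[0,1]\to X$ from $a$ to $b$, the singular simplex $\tilde\gamma^{(n)}:\Delta^n\to X^n$, $(t_1,\ldots,t_n)\mapsto(\tilde\gamma(t_1),\ldots,\tilde\gamma(t_n))$, is a cycle relative to $Y^{(n)}_{ab}$; let $[\tilde\gamma^{(n)}]\in\mathbf H_n(X,a,b)$ be its class. Theorem. For every $n\ge0$ and every $\underline X=(X,a,b)$ in $\mathbf{Top}_2$, there is a unique group morphism $\nu^{(n)}_{\underline X}:\mathbf F_n(\underline X)\to\mathbf H_n(\underline X)$ that sends, for every path $\tilde\gamma$ from $a$ to $b$, the image in $\mathbf F_n(\underline X)$ of the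 homotopy class of $\tilde\gamma$ to $[\tilde\gamma^{(n)}]$. The assignment $\underline X\mapsto\nu^{(n)}_{\underline X}$ is a natural transformation from $\mathbf F_n$ to $\mathbf H_n$. -/

import Mathlib

open CategoryTheory

universe u

noncomputable section

namespace PathHomology

/-! ### Singular simplices and relative singular homology -/

section Singular

/-- The simplex `Δ^n = {(t₁, …, t_n) | 0 ≤ t₁ ≤ ⋯ ≤ t_n ≤ 1}`, with the topology induced
by `[0,1]^n`. -/
abbrev Simplex (n : ℕ) : Type := {t : Fin n → unitInterval // Monotone t}

/-- The sequence `(x₀, x₁, …, x_n, x_{n+1})` obtained from `(x₁, …, x_n)` by adding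
`x₀ = a` and `x_{n+1} = b`. -/
def withEnds {X : Type u} {n : ℕ} (a b : X) (x : Fin n → X) : Fin (n + 2) → X :=
  Fin.cons (α := fun _ => X) a (Fin.snoc (α := fun _ => X) x b)

theorem withEnds_zero {X : Type u} {n : ℕ} (a b : X) (x : Fin n → X) :
    withEnds a b x 0 = a := rfl

theorem withEnds_mid {X : Type u} {n : ℕ} (a b : X) (x : Fin n → X) (j : Fin n) :
    withEnds a b x j.castSucc.succ = x j := by
  simp [withEnds]

theorem withEnds_last {X : Type u} {n : ℕ} (a b : X) (x : Fin n → X) :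
    withEnds a b x (Fin.last (n + 1)) = b := by
  simp [withEnds, ← Fin.succ_last]

theorem withEnds_map {X X' : Type u} {n : ℕ} (f : X → X') (a b : X) (x : Fin n → X)
    (j : Fin (n + 2)) : withEnds (f a) (f b) (fun i => f (x i)) j = f (withEnds a b x j) := by
  induction j using Fin.cases with
  | zero => rfl
  | succ j =>
    induction j using Fin.lastCases with
    | last => rw [Fin.succ_last, withEnds_last, withEnds_last]
    | cast j => rw [withEnds_mid, withEnds_mid]

theorem withEnds_monotone {n : ℕ} (t : Simplex n) :
    Monotone (withEnds (0 : unitInterval) 1 t.1) := by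
  intro i j hij
  induction i using Fin.cases with
  | zero => exact unitInterval.nonneg'
  | succ i =>
    induction i using Fin.lastCases with
    | last =>
      have : j = Fin.last (n + 1) := by
        apply le_antisymm (Fin.le_last _); simpa [Fin.succ_last] using hij
      rw [this, Fin.succ_last]
    | cast i =>
      induction j using Fin.cases with
      | zero => exact absurd hij (by simp)
      | succ j =>
        induction j using Fin.lastCases with
        | last => rw [Fin.succ_last, withEnds_last]; exact unitInterval.le_one'
        | cast j =>
          rw [withEnds_mid, withEnds_mid]
          have hij' : i ≤ j := Fin.castSucc_le_castSucc_iff.1 (Fin.succ_le_succ_iff.1 hij)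
          exact t.2 hij'

/-- The indices read off by the `i`-th face map: coordinate number `j + 1` is `t_{j+1}` if
`j < i` and `t_j` otherwise. -/
def faceIndex {n : ℕ} (i : Fin (n + 2)) (j : Fin (n + 1)) : Fin (n + 2) :=
  if j.castSucc < i then j.succ else j.castSucc

theorem faceIndex_monotone {n : ℕ} (i : Fin (n + 2)) : Monotone (faceIndex i) := by
  intro j k hjk
  unfold faceIndex
  split_ifs <;> simp only [Fin.le_def, Fin.lt_def, Fin.val_succ, Fin.val_castSucc] at * <;> omega

/-- The face map `∂_i : Δ^n → Δ^{n+1}`,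
`(t₁, …, t_n) ↦ (t₁, …, t_i, t_i, …, t_n)`, with `t₀ = 0` and `t_{n+1} = 1`. -/
def face {n : ℕ} (i : Fin (n + 2)) : C(Simplex n, Simplex (n + 1)) where
  toFun t := ⟨fun j => withEnds 0 1 t.1 (faceIndex i j),
    (withEnds_monotone t).comp (faceIndex_monotone i)⟩
  continuous_toFun := by
    refine Continuous.subtype_mk (continuous_pi fun j => ?_) _
    generalize faceIndex i j = k
    induction k using Fin.cases with
    | zero => exact continuous_const
    | succ k =>
      induction k using Fin.lastCases with
      | last => simp only [Fin.succ_last, withEnds_last]; exact continuous_const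
      | cast k =>
        simp only [withEnds_mid]
        exact (continuous_apply k).comp continuous_subtype_val

variable {A B D : Type u} [TopologicalSpace A] [TopologicalSpace B] [TopologicalSpace D]

/-- The group of singular chains `C_n(A)`, free on the continuous maps `Δ^n → A`. -/
abbrev Chain (n : ℕ) (A : Type u) [TopologicalSpace A] : Type u := C(Simplex n, A) →₀ ℤ

/-- The singular differential `C_{n+1}(A) → C_n(A)`, `σ ↦ ∑ i, (-1)^i σ ∘ ∂_i`. -/
def boundary (n : ℕ) (A : Type u) [TopologicalSpace A] : Chain (n + 1) A →ₗ[ℤ] Chain n A :=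
  ∑ i : Fin (n + 2), (-1 : ℤ) ^ (i : ℕ) •
    Finsupp.lmapDomain ℤ ℤ (fun σ : C(Simplex (n + 1), A) => σ.comp (face i))

/-- The subgroup `C_n(Y) ⊆ C_n(A)` spanned by the singular simplices with image in `Y`. -/
def subChain (n : ℕ) (Y : Set A) : Submodule ℤ (Chain n A) :=
  Finsupp.supported ℤ ℤ {σ : C(Simplex n, A) | ∀ t, σ t ∈ Y}

theorem boundary_single (n : ℕ) (σ : C(Simplex (n + 1), A)) (c : ℤ) :
    boundary n A (Finsupp.single σ c) =
      ∑ i : Fin (n + 2), (-1 : ℤ) ^ (i : ℕ) • Finsupp.single (σ.comp (face i)) c := by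
  simp only [boundary, LinearMap.sum_apply, LinearMap.smul_apply, Finsupp.lmapDomain_apply,
    Finsupp.mapDomain_single]

theorem single_mem_subChain {n : ℕ} {Y : Set A} {σ : C(Simplex n, A)} (h : ∀ t, σ t ∈ Y)
    (c : ℤ) : Finsupp.single σ c ∈ subChain n Y :=
  Finsupp.single_mem_supported ℤ c h

theorem subChain_le {n : ℕ} {Y : Set A} {S : Submodule ℤ (Chain n A)}
    (h : ∀ σ : C(Simplex n, A), (∀ t, σ t ∈ Y) → Finsupp.single σ 1 ∈ S) : subChain n Y ≤ S := by
  rw [subChain, Finsupp.supported_eq_span_single, Submodule.span_le]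
  rintro _ ⟨σ, hσ, rfl⟩
  exact h σ hσ

theorem subChain_boundary (n : ℕ) (Y : Set A) :
    subChain (n + 1) Y ≤ (subChain n Y).comap (boundary n A) := by
  refine subChain_le fun σ hσ => ?_
  rw [Submodule.mem_comap, boundary_single]
  exact Submodule.sum_mem _ fun i _ =>
    Submodule.smul_mem _ _ (single_mem_subChain (σ := σ.comp (face i)) (fun t => hσ (face i t)) _)

/-- Simplicial identity `∂_j ∘ ∂_i = ∂_{i+1} ∘ ∂_j` for `j ≤ i`. -/
theorem face_comp_face {n : ℕ} (i : Fin (n + 2)) (j : Fin (n + 3)) (h : (j : ℕ) ≤ i) :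
    (face j).comp (face i) =
      (face i.succ).comp (face (j.castLT (lt_of_le_of_lt h i.isLt))) := by
  have key : ∀ {m : ℕ} (t : Simplex m) (i : Fin (m + 2)) (k : Fin (m + 3)) (l : Fin (m + 2)),
      (((k : ℕ) ≤ i ∧ (l : ℕ) = k) ∨ ((i : ℕ) < k ∧ (l : ℕ) + 1 = k)) →
      withEnds (0 : unitInterval) 1 (face i t).1 k = withEnds 0 1 t.1 l := by
    intro m t i k l hkl
    induction k using Fin.cases with
    | zero =>
      have : l = 0 := by
        apply Fin.ext
        simp only [Fin.val_zero] at hkl ⊢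
        omega
      rw [this, withEnds_zero, withEnds_zero]
    | succ k =>
      induction k using Fin.lastCases with
      | last =>
        have : l = Fin.last (m + 1) := by
          apply Fin.ext
          have := i.isLt
          simp only [Fin.val_succ, Fin.val_last] at hkl ⊢
          omega
        rw [this, Fin.succ_last, withEnds_last, withEnds_last]
      | cast k =>
        rw [withEnds_mid]
        change withEnds 0 1 t.1 (faceIndex i k) = _
        congr 1
        apply Fin.ext
        unfold faceIndex
        simp only [Fin.val_succ, Fin.val_castSucc] at hkl
        split_ifs with h1 <;> simp only [Fin.lt_def, Fin.val_succ, Fin.val_castSucc] at * <;> omega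
  ext t k : 3
  change withEnds 0 1 (face i t).1 (faceIndex j k) =
    withEnds 0 1 (face (j.castLT (lt_of_le_of_lt h i.isLt)) t).1 (faceIndex i.succ k)
  have hi := i.isLt
  have hk := k.isLt
  obtain ⟨l, hl⟩ : ∃ l : Fin (n + 2),
      (l : ℕ) = if (k : ℕ) < j then (k : ℕ) + 1 else if (k : ℕ) ≤ i then (k : ℕ) else k - 1 :=
    ⟨⟨if (k : ℕ) < j then (k : ℕ) + 1 else if (k : ℕ) ≤ i then (k : ℕ) else k - 1, by
      split_ifs <;> omega⟩, rfl⟩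
  rw [key t i (faceIndex j k) l, key t (j.castLT _) (faceIndex i.succ k) l]
  · unfold faceIndex
    simp only [Fin.lt_def, Fin.val_castSucc, Fin.val_succ, Fin.val_castLT]
    split_ifs at hl ⊢ <;> simp only [Fin.val_succ, Fin.val_castSucc] <;> omega
  · unfold faceIndex
    simp only [Fin.lt_def, Fin.val_castSucc]
    split_ifs at hl ⊢ <;> simp only [Fin.val_succ, Fin.val_castSucc] <;> omega

theorem boundary_boundary (n : ℕ) (A : Type u) [TopologicalSpace A] :
    (boundary n A).comp (boundary (n + 1) A) = 0 := by
  refine Finsupp.lhom_ext fun σ c => ?_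
  simp only [LinearMap.comp_apply, boundary_single, map_sum, map_smul, LinearMap.zero_apply,
    Finset.smul_sum, smul_smul, ContinuousMap.comp_assoc]
  rw [Finset.sum_comm]
  simp only [← Finset.sum_product']
  let P := Fin (n + 2) × Fin (n + 3)
  let S : Finset P := {ij : P | (ij.2 : ℕ) ≤ (ij.1 : ℕ)}
  rw [Finset.univ_product_univ, ← Finset.sum_add_sum_compl S, ← eq_neg_iff_add_eq_zero,
    ← Finset.sum_neg_distrib]
  let φ : ∀ ij : P, ij ∈ S → P := fun ij hij =>
    (Fin.castLT ij.2 (lt_of_le_of_lt (Finset.mem_filter.mp hij).right (Fin.is_lt ij.1)), ij.1.succ)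
  apply Finset.sum_bij φ
  · intro ij hij
    simp_rw [S, φ, Finset.compl_filter, Finset.mem_filter_univ, Fin.val_succ,
      Fin.val_castLT] at hij ⊢
    lia
  · rintro ⟨i, j⟩ hij ⟨i', j'⟩ hij' h
    have h1 := congrArg (fun p : P => (p.1 : ℕ)) h
    have h2 := congrArg (fun p : P => (p.2 : ℕ)) h
    simp only [φ, Fin.val_castLT, Fin.val_succ] at h1 h2
    exact Prod.ext (Fin.ext (by simpa using h2)) (Fin.ext h1)
  · rintro ⟨i', j'⟩ hij'
    simp_rw [S, Finset.compl_filter, Finset.mem_filter_univ, not_le] at hij'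
    refine ⟨(j'.pred <| ?_, Fin.castSucc i'), ?_, ?_⟩
    · rintro rfl
      simp only [Fin.val_zero, not_lt_zero] at hij'
    · simpa [S] using! Nat.le_sub_one_of_lt hij'
    · simp only [φ, Fin.castLT_castSucc, Fin.succ_pred]
  · rintro ⟨i, j⟩ hij
    have hij' : (j : ℕ) ≤ i := by simpa [S] using hij
    simp only [φ, ← neg_smul]
    rw [face_comp_face i j hij']
    congr 1
    simp only [Fin.val_succ, Fin.val_castLT, pow_succ]
    ring

/-- Relative chains `C_n(A) / C_n(Y)`. -/
abbrev RelChain (n : ℕ) (Y : Set A) : Type u := Chain n A ⧸ subChain n Y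

/-- The differential of the quotient complex `C_•(A) / C_•(Y)`. -/
def relBoundary (n : ℕ) (Y : Set A) : RelChain (n + 1) Y →ₗ[ℤ] RelChain n Y :=
  (subChain (n + 1) Y).mapQ (subChain n Y) (boundary n A) (subChain_boundary n Y)

theorem relBoundary_relBoundary (n : ℕ) (Y : Set A) (x : RelChain (n + 2) Y) :
    relBoundary n Y (relBoundary (n + 1) Y x) = 0 := by
  obtain ⟨x, rfl⟩ := Submodule.mkQ_surjective _ x
  have h := LinearMap.congr_fun (boundary_boundary n A) x
  rw [LinearMap.comp_apply, LinearMap.zero_apply] at h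
  simp only [relBoundary, Submodule.mkQ_apply, Submodule.mapQ_apply, h]
  rfl

/-- Relative `n`-cycles; in degree `0` every chain is a cycle, since `C_{-1} = 0`. -/
def relCycles : (n : ℕ) → (Y : Set A) → Submodule ℤ (RelChain n Y)
  | 0, _ => ⊤
  | n + 1, Y => LinearMap.ker (relBoundary n Y)

/-- Relative `n`-boundaries. -/
def relBoundaries (n : ℕ) (Y : Set A) : Submodule ℤ (RelChain n Y) :=
  LinearMap.range (relBoundary n Y)

theorem relBoundaries_le_relCycles (n : ℕ) (Y : Set A) :
    relBoundaries n Y ≤ relCycles n Y := by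
  rintro _ ⟨x, rfl⟩
  cases n with
  | zero => exact Submodule.mem_top
  | succ n => exact relBoundary_relBoundary n Y x

/-- Relative singular homology `H_n(A, Y)`: the homology of `C_•(A) / C_•(Y)`. -/
abbrev RelHomology (n : ℕ) (Y : Set A) : Type u :=
  relCycles n Y ⧸ (relBoundaries n Y).submoduleOf (relCycles n Y)

/-- The class in `H_n(A, Y)` of a chain of `A` that is a cycle relative to `Y`. -/
def relClass {n : ℕ} {Y : Set A} (c : Chain n A)
    (hc : (subChain n Y).mkQ c ∈ relCycles n Y) : RelHomology n Y :=
  Submodule.Quotient.mk ⟨(subChain n Y).mkQ c, hc⟩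

/-- The map of chains `σ ↦ f ∘ σ`. -/
def chainMap (n : ℕ) (f : C(A, B)) : Chain n A →ₗ[ℤ] Chain n B :=
  Finsupp.lmapDomain ℤ ℤ (fun σ => f.comp σ)

theorem chainMap_single (n : ℕ) (f : C(A, B)) (σ : C(Simplex n, A)) (c : ℤ) :
    chainMap n f (Finsupp.single σ c) = Finsupp.single (f.comp σ) c := by
  simp [chainMap]

theorem subChain_map (n : ℕ) (f : C(A, B)) {Y : Set A} {Z : Set B} (hf : Set.MapsTo f Y Z) :
    subChain n Y ≤ (subChain n Z).comap (chainMap n f) := by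
  refine subChain_le fun σ hσ => ?_
  rw [Submodule.mem_comap, chainMap_single]
  exact single_mem_subChain (fun t => hf (hσ t)) _

/-- The map of relative chains induced by a map of pairs `(A, Y) → (B, Z)`. -/
def relChainMap (n : ℕ) (f : C(A, B)) {Y : Set A} {Z : Set B} (hf : Set.MapsTo f Y Z) :
    RelChain n Y →ₗ[ℤ] RelChain n Z :=
  (subChain n Y).mapQ (subChain n Z) (chainMap n f) (subChain_map n f hf)

theorem boundary_chainMap (n : ℕ) (f : C(A, B)) (c : Chain (n + 1) A) :
    boundary n B (chainMap (n + 1) f c) = chainMap n f (boundary n A c) := by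
  induction c using Finsupp.induction_linear with
  | zero => simp
  | add c d hc hd => rw [map_add, map_add, map_add, map_add, hc, hd]
  | single σ c =>
    simp only [chainMap_single, boundary_single, map_sum, map_smul, ContinuousMap.comp_assoc]

theorem relBoundary_relChainMap (n : ℕ) (f : C(A, B)) {Y : Set A} {Z : Set B}
    (hf : Set.MapsTo f Y Z) (x : RelChain (n + 1) Y) :
    relBoundary n Z (relChainMap (n + 1) f hf x) = relChainMap n f hf (relBoundary n Y x) := by
  obtain ⟨x, rfl⟩ := Submodule.mkQ_surjective _ x
  simp only [relBoundary, relChainMap, Submodule.mkQ_apply, Submodule.mapQ_apply,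
    boundary_chainMap]

theorem relChainMap_mem_relCycles (n : ℕ) (f : C(A, B)) {Y : Set A} {Z : Set B}
    (hf : Set.MapsTo f Y Z) (x : RelChain n Y) (hx : x ∈ relCycles n Y) :
    relChainMap n f hf x ∈ relCycles n Z := by
  cases n with
  | zero => exact Submodule.mem_top
  | succ n =>
    have hx' : relBoundary n Y x = 0 := hx
    change relBoundary n Z _ = 0
    rw [relBoundary_relChainMap, hx', map_zero]

theorem relBoundaries_map (n : ℕ) (f : C(A, B)) {Y : Set A} {Z : Set B}
    (hf : Set.MapsTo f Y Z) :
    (relBoundaries n Y).submoduleOf (relCycles n Y) ≤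
      ((relBoundaries n Z).submoduleOf (relCycles n Z)).comap
        ((relChainMap n f hf).restrict (relChainMap_mem_relCycles n f hf)) := by
  rintro ⟨x, hx⟩ ⟨y, hy⟩
  refine ⟨relChainMap (n + 1) f hf y, ?_⟩
  rw [relBoundary_relChainMap, hy]
  rfl

/-- The map `f_* : H_n(A, Y) → H_n(B, Z)` induced by a map of pairs `(A, Y) → (B, Z)`. -/
def relHomologyMap (n : ℕ) (f : C(A, B)) {Y : Set A} {Z : Set B} (hf : Set.MapsTo f Y Z) :
    RelHomology n Y →ₗ[ℤ] RelHomology n Z :=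
  Submodule.mapQ _ _ ((relChainMap n f hf).restrict (relChainMap_mem_relCycles n f hf))
    (relBoundaries_map n f hf)

theorem relHomologyMap_id (n : ℕ) (Y : Set A) (f : C(A, A)) (hf : Set.MapsTo f Y Y)
    (h : f = ContinuousMap.id A) (x : RelHomology n Y) : relHomologyMap n f hf x = x := by
  subst h
  obtain ⟨⟨x, hx⟩, rfl⟩ := Submodule.mkQ_surjective _ x
  obtain ⟨x, rfl⟩ := Submodule.mkQ_surjective _ x
  have : chainMap n (ContinuousMap.id A) x = x := Finsupp.mapDomain_id
  refine congrArg (Submodule.Quotient.mk (p := _)) (Subtype.ext ?_)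
  exact congrArg (Submodule.Quotient.mk (p := _)) this

theorem relHomologyMap_comp (n : ℕ) (f : C(A, B)) (g : C(B, D)) (k : C(A, D)) {Y : Set A}
    {Z : Set B} {W : Set D} (hf : Set.MapsTo f Y Z) (hg : Set.MapsTo g Z W)
    (hk : Set.MapsTo k Y W) (h : k = g.comp f) (x : RelHomology n Y) :
    relHomologyMap n k hk x = relHomologyMap n g hg (relHomologyMap n f hf x) := by
  subst h
  obtain ⟨⟨x, hx⟩, rfl⟩ := Submodule.mkQ_surjective _ x
  obtain ⟨x, rfl⟩ := Submodule.mkQ_surjective _ x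
  have : chainMap n (g.comp f) x = chainMap n g (chainMap n f x) :=
    Finsupp.mapDomain_comp (f := fun σ : C(Simplex n, A) => f.comp σ)
      (g := fun σ : C(Simplex n, B) => g.comp σ)
  refine congrArg (Submodule.Quotient.mk (p := _)) (Subtype.ext ?_)
  exact congrArg (Submodule.Quotient.mk (p := _)) this

end Singular

/-! ### Bipointed spaces -/

/-- Topological spaces with an ordered pair of marked points. -/
structure Top₂ : Type (u + 1) where
  /-- the underlying space -/
  carrier : Type u
  [top : TopologicalSpace carrier]
  /-- the first marked point -/
  a : carrier
  /-- the second marked point -/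
  b : carrier

attribute [instance] Top₂.top

/-- Continuous maps that respect both marked points. -/
@[ext]
structure Top₂.Hom (X X' : Top₂.{u}) : Type u where
  /-- the underlying continuous map -/
  map : C(X.carrier, X'.carrier)
  map_a : map X.a = X'.a
  map_b : map X.b = X'.b

instance : Category Top₂.{u} where
  Hom := Top₂.Hom
  id X := ⟨ContinuousMap.id _, rfl, rfl⟩
  comp f g := ⟨g.map.comp f.map, by simp [f.map_a, g.map_a], by simp [f.map_b, g.map_b]⟩

/-! ### The functor `H_n` -/

section FunctorH

/-- `Y_{ab}^{(n)} = ⋃_{i=0}^n {(x₁, …, x_n) | x_i = x_{i+1}}`, where `x₀ = a`, `x_{n+1} = b`. -/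
def diagSet {X : Type u} (n : ℕ) (a b : X) : Set (Fin n → X) :=
  ⋃ i : Fin (n + 1), {x | withEnds a b x i.castSucc = withEnds a b x i.succ}

/-- The map `f^n : X^n → X'^n`. -/
def powMap {X X' : Type u} [TopologicalSpace X] [TopologicalSpace X'] (n : ℕ) (f : C(X, X')) :
    C(Fin n → X, Fin n → X') where
  toFun x i := f (x i)
  continuous_toFun := by fun_prop

theorem powMap_mapsTo {X X' : Top₂.{u}} (n : ℕ) (f : X ⟶ X') :
    Set.MapsTo (powMap n f.map) (diagSet n X.a X.b) (diagSet n X'.a X'.b) := by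
  intro x hx
  obtain ⟨i, hi⟩ := Set.mem_iUnion.1 hx
  refine Set.mem_iUnion.2 ⟨i, ?_⟩
  change withEnds X'.a X'.b (fun j => f.map (x j)) _ = withEnds X'.a X'.b (fun j => f.map (x j)) _
  rw [← f.map_a, ← f.map_b, withEnds_map, withEnds_map]
  exact congrArg _ hi

/-- The functor `(X, a, b) ↦ H_n(X^n, Y_{ab}^{(n)})`. -/
def functorH (n : ℕ) : Top₂.{u} ⥤ AddCommGrpCat.{u} where
  obj X := AddCommGrpCat.of (RelHomology n (diagSet n X.a X.b))
  map f := AddCommGrpCat.ofHom (relHomologyMap n (powMap n f.map) (powMap_mapsTo n f)).toAddMonoidHom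
  map_id X := by
    ext x
    exact relHomologyMap_id n _ (powMap n (𝟙 X : X ⟶ X).map) (powMap_mapsTo n (𝟙 X)) rfl x
  map_comp f g := by
    ext x
    exact relHomologyMap_comp n (powMap n f.map) (powMap n g.map) (powMap n (f ≫ g).map)
      (powMap_mapsTo n f) (powMap_mapsTo n g) (powMap_mapsTo n (f ≫ g)) rfl x

variable {X : Type u} [TopologicalSpace X] {a b : X}

/-- The singular simplex `γ^{(n)} : Δ^n → X^n`, `(t₁, …, t_n) ↦ (γ(t₁), …, γ(t_n))`. -/
def pathSimplex (n : ℕ) (γ : Path a b) : C(Simplex n, Fin n → X) where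
  toFun t i := γ (t.1 i)
  continuous_toFun := continuous_pi fun i =>
    γ.continuous.comp ((continuous_apply i).comp continuous_subtype_val)

theorem pathSimplex_face_mem (n : ℕ) (γ : Path a b) (i : Fin (n + 2)) (t : Simplex n) :
    pathSimplex (n + 1) γ (face i t) ∈ diagSet (n + 1) a b := by
  refine Set.mem_iUnion.2 ⟨i, ?_⟩
  have h : ∀ k, withEnds a b (pathSimplex (n + 1) γ (face i t)) k =
      γ (withEnds 0 1 (face i t).1 k) := by
    intro k
    induction k using Fin.cases with
    | zero => exact γ.source.symm
    | succ k =>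
      induction k using Fin.lastCases with
      | last => rw [Fin.succ_last, withEnds_last, withEnds_last, γ.target]
      | cast k => rw [withEnds_mid, withEnds_mid]; rfl
  have h' : withEnds 0 1 (face i t).1 i.castSucc = withEnds 0 1 (face i t).1 i.succ := by
    have hl : ∀ (p : Fin (n + 2)) , p ≠ 0 → (p : ℕ) ≤ i →
        withEnds 0 1 (face i t).1 p.castSucc = withEnds 0 1 t.1 p := by
      intro p hp hpi
      obtain ⟨q, rfl⟩ := Fin.exists_succ_eq.2 hp
      rw [← Fin.succ_castSucc, withEnds_mid]
      change withEnds 0 1 t.1 (faceIndex i q) = _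
      rw [faceIndex, if_pos]
      simpa [Fin.lt_def, Nat.succ_le_iff] using hpi
    have hr : ∀ (p : Fin (n + 2)) , p ≠ Fin.last _ → (i : ℕ) ≤ p →
        withEnds 0 1 (face i t).1 p.succ = withEnds 0 1 t.1 p := by
      intro p hp hpi
      obtain ⟨q, rfl⟩ := Fin.exists_castSucc_eq.2 hp
      rw [withEnds_mid]
      change withEnds 0 1 t.1 (faceIndex i q) = _
      rw [faceIndex, if_neg]
      simpa [Fin.lt_def] using hpi
    have hl' : withEnds 0 1 (face i t).1 i.castSucc = withEnds 0 1 t.1 i := by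
      by_cases hi : i = 0
      · subst hi; rfl
      · exact hl i hi le_rfl
    have hr' : withEnds 0 1 (face i t).1 i.succ = withEnds 0 1 t.1 i := by
      by_cases hi : i = Fin.last _
      · subst hi; rw [Fin.succ_last, withEnds_last, withEnds_last]
      · exact hr i hi le_rfl
    rw [hl', hr']
  change withEnds a b _ _ = withEnds a b _ _
  rw [h, h, h']

theorem pathSimplex_mem_relCycles (n : ℕ) (γ : Path a b) :
    (subChain n (diagSet n a b)).mkQ (Finsupp.single (pathSimplex n γ) 1) ∈
      relCycles n (diagSet n a b) := by
  cases n with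
  | zero => exact Submodule.mem_top
  | succ n =>
    change relBoundary n _ _ = 0
    rw [relBoundary, Submodule.mkQ_apply, Submodule.mapQ_apply, Submodule.Quotient.mk_eq_zero,
      boundary_single]
    exact Submodule.sum_mem _ fun i _ =>
      Submodule.smul_mem _ _ (single_mem_subChain (pathSimplex_face_mem n γ i) _)

/-- The class `[γ^{(n)}] ∈ H_n(X^n, Y_{ab}^{(n)})` of a path `γ` from `a` to `b`. -/
def pathClass (n : ℕ) (γ : Path a b) : RelHomology n (diagSet n a b) :=
  relClass (Finsupp.single (pathSimplex n γ) 1) (pathSimplex_mem_relCycles n γ)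

end FunctorH

/-! ### The functor `F_n` -/

section FunctorF

variable {X : Type u} [TopologicalSpace X]

/-- The free abelian group `ℤπ₁(a,b)` on the homotopy classes of paths from `a` to `b`. -/
abbrev PathModule (a b : X) : Type u := Path.Homotopic.Quotient a b →₀ ℤ

/-- The group ring `ℤπ₁(a)`. The product `α β` of `π₁(a)` is the class of `β` followed
by `α`. -/
abbrev GroupRing (a : X) : Type u := MonoidAlgebra ℤ (FundamentalGroup X a)

/-- The right action `ℤπ₁(a,b) × ℤπ₁(a) → ℤπ₁(a,b)`: the bilinear extension of
`(γ, α) ↦ γ · α`, the class of `α` followed by `γ`. -/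
def rightAction (a b : X) : PathModule a b →ₗ[ℤ] GroupRing a →ₗ[ℤ] PathModule a b :=
  Finsupp.lift _ ℤ _ fun γ =>
    Finsupp.lmapDomain ℤ ℤ (fun α : FundamentalGroup X a => α.toPath.trans γ) ∘ₗ
      (MonoidAlgebra.coeffLinearEquiv ℤ).toLinearMap

/-- The augmentation `ℤπ₁(a) → ℤ`, `α ↦ 1`. -/
def augmentation (a : X) : GroupRing a →ₐ[ℤ] ℤ :=
  MonoidAlgebra.lift ℤ ℤ (FundamentalGroup X a) 1

/-- The augmentation ideal `(ℤπ₁(a))₊`, as a subgroup of `ℤπ₁(a)`. -/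
def augIdeal (a : X) : Submodule ℤ (GroupRing a) :=
  LinearMap.ker (augmentation a).toLinearMap

/-- The subgroup `ℤπ₁(a,b) · (ℤπ₁(a))₊^m` of `ℤπ₁(a,b)`, generated by the products of an element
of `ℤπ₁(a,b)` and an element of the `m`-th power of the augmentation ideal. -/
def augSubmodule (m : ℕ) (a b : X) : Submodule ℤ (PathModule a b) :=
  Submodule.map₂ (rightAction a b) ⊤ (augIdeal a ^ m)

/-- `F_n(X,a,b) = ℤπ₁(a,b) / ℤπ₁(a,b)(ℤπ₁(a))₊^{n+1}`. -/
abbrev FQuot (n : ℕ) (a b : X) : Type u := PathModule a b ⧸ augSubmodule (n + 1) a b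

/-- The image in `F_n(X,a,b)` of the homotopy class of a path. -/
def pathGen (n : ℕ) {a b : X} (γ : Path a b) : FQuot n a b :=
  Submodule.Quotient.mk (Finsupp.single (Path.Homotopic.Quotient.mk γ) 1)

/-- The map `π₁(a,b) → π₁(a',b')` induced by a map of bipointed spaces. -/
def classMap {X X' : Top₂.{u}} (f : X ⟶ X') (γ : Path.Homotopic.Quotient X.a X.b) :
    Path.Homotopic.Quotient X'.a X'.b :=
  (γ.map f.map).cast f.map_a.symm f.map_b.symm

/-- The map `ℤπ₁(a,b) → ℤπ₁(a',b')` induced by a map of bipointed spaces. -/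
def pathModuleMap {X X' : Top₂.{u}} (f : X ⟶ X') :
    PathModule X.a X.b →ₗ[ℤ] PathModule X'.a X'.b :=
  Finsupp.lmapDomain ℤ ℤ (classMap f)

theorem classMap_trans {X X' : Top₂.{u}} (f : X ⟶ X') (α : FundamentalGroup X.carrier X.a)
    (γ : Path.Homotopic.Quotient X.a X.b) :
    classMap f (α.toPath.trans γ) =
      (FundamentalGroup.mapOfEq f.map f.map_a α).toPath.trans (classMap f γ) := by
  rw [FundamentalGroup.toPath, FundamentalGroup.toPath, FundamentalGroup.toArrow,
    FundamentalGroup.toArrow, FundamentalGroup.mapOfEq_apply]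
  obtain ⟨γ, rfl⟩ := Path.Homotopic.Quotient.mk_surjective γ
  obtain ⟨α, rfl⟩ := Path.Homotopic.Quotient.mk_surjective α
  refine congrArg Path.Homotopic.Quotient.mk ?_
  ext t
  change f.map ((α.trans γ) t) = _
  simp only [Path.trans_apply]
  split_ifs <;> rfl

/-- The ring map `ℤπ₁(a) → ℤπ₁(a')` induced by a map of bipointed spaces. -/
def groupRingMap {X X' : Top₂.{u}} (f : X ⟶ X') : GroupRing X.a →ₐ[ℤ] GroupRing X'.a :=
  MonoidAlgebra.mapDomainAlgHom ℤ ℤ (FundamentalGroup.mapOfEq f.map f.map_a)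

theorem rightAction_single {a b : X} (γ : Path.Homotopic.Quotient a b)
    (α : FundamentalGroup X a) (c d : ℤ) :
    rightAction a b (Finsupp.single γ c) (MonoidAlgebra.single α d) =
      Finsupp.single (α.toPath.trans γ) (c * d) := by
  simp [rightAction]

theorem pathModuleMap_rightAction {X X' : Top₂.{u}} (f : X ⟶ X') (x : PathModule X.a X.b)
    (y : GroupRing X.a) :
    pathModuleMap f (rightAction X.a X.b x y) =
      rightAction X'.a X'.b (pathModuleMap f x) (groupRingMap f y) := by
  induction x using Finsupp.induction_linear with
  | zero => simp
  | add x x' hx hx' => simp only [map_add, LinearMap.add_apply, hx, hx']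
  | single γ c =>
    induction y using MonoidAlgebra.induction_linear with
    | zero => simp
    | add y y' hy hy' => simp only [map_add, hy, hy']
    | single α d =>
      simp only [rightAction_single, pathModuleMap, groupRingMap, Finsupp.lmapDomain_apply,
        Finsupp.mapDomain_single, MonoidAlgebra.mapDomainAlgHom_apply,
        MonoidAlgebra.mapDomain_single, classMap_trans]

theorem augmentation_groupRingMap {X X' : Top₂.{u}} (f : X ⟶ X') (y : GroupRing X.a) :
    augmentation X'.a (groupRingMap f y) = augmentation X.a y := by
  induction y using MonoidAlgebra.induction_linear with
  | zero => simp
  | add y y' hy hy' => simp only [map_add, hy, hy']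
  | single α d => simp [augmentation, groupRingMap]

theorem augSubmodule_map {X X' : Top₂.{u}} (m : ℕ) (f : X ⟶ X') :
    augSubmodule m X.a X.b ≤ (augSubmodule m X'.a X'.b).comap (pathModuleMap f) := by
  refine Submodule.map₂_le.2 fun x _ y hy => ?_
  rw [Submodule.mem_comap, pathModuleMap_rightAction]
  refine Submodule.apply_mem_map₂ _ Submodule.mem_top ?_
  have h : (augIdeal X.a).map (groupRingMap f).toLinearMap ≤ augIdeal X'.a := by
    rintro _ ⟨z, hz, rfl⟩
    exact (augmentation_groupRingMap f z).trans hz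
  refine pow_le_pow_left' h m ?_
  rw [← Submodule.map_pow]
  exact Submodule.mem_map_of_mem hy

/-- The map `F_n(X,a,b) → F_n(X',a',b')` induced by a map of bipointed spaces. -/
def FQuotMap {X X' : Top₂.{u}} (n : ℕ) (f : X ⟶ X') :
    FQuot n X.a X.b →ₗ[ℤ] FQuot n X'.a X'.b :=
  Submodule.mapQ _ _ (pathModuleMap f) (augSubmodule_map (n + 1) f)

theorem classMap_id (X : Top₂.{u}) : classMap (𝟙 X) = id := by
  funext γ
  obtain ⟨γ, rfl⟩ := Path.Homotopic.Quotient.mk_surjective γ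
  rfl

theorem classMap_comp {X X' X'' : Top₂.{u}} (f : X ⟶ X') (g : X' ⟶ X'') :
    classMap (f ≫ g) = classMap g ∘ classMap f := by
  funext γ
  obtain ⟨γ, rfl⟩ := Path.Homotopic.Quotient.mk_surjective γ
  rfl

/-- The functor `(X, a, b) ↦ F_n(X,a,b)`. -/
def functorF (n : ℕ) : Top₂.{u} ⥤ AddCommGrpCat.{u} where
  obj X := AddCommGrpCat.of (FQuot n X.a X.b)
  map f := AddCommGrpCat.ofHom (FQuotMap n f).toAddMonoidHom
  map_id X := by
    ext x
    obtain ⟨x, rfl⟩ := Submodule.mkQ_surjective _ x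
    have h : pathModuleMap (𝟙 X) x = x := by
      rw [pathModuleMap, Finsupp.lmapDomain_apply, classMap_id, Finsupp.mapDomain_id]
    exact congrArg (Submodule.Quotient.mk (p := _)) h
  map_comp f g := by
    ext x
    obtain ⟨x, rfl⟩ := Submodule.mkQ_surjective _ x
    have h : pathModuleMap (f ≫ g) x = pathModuleMap g (pathModuleMap f x) := by
      simp only [pathModuleMap, Finsupp.lmapDomain_apply, classMap_comp, Finsupp.mapDomain_comp]
    exact congrArg (Submodule.Quotient.mk (p := _)) h

end FunctorF

end PathHomology

end

open PathHomology

/-! A path `γ` from `a` to `b` extends, by clamping coordinates, to a map `ℝ^n → X^n` that carries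
each wall `x_i = x_{i+1}` (with `x_0 = 0`, `x_{n+1} = 1`) into `Y_{ab}^{(n)}`, and `[γ^{(n)}]` is
the image of the standard simplex, whose `i`-th face lies on the `i`-th wall. The walls are convex,
so affine chains can be filled by cones without leaving them. Hence a chain map of ordered affine
chains that vanishes on the augmentation term and respects every wall sends the standard simplex to
a boundary relative to `Y_{ab}^{(n)}` (`realize_stdVertex_mem`). Applied to the difference of the
two ends of `ℝ^n × ℝ`, this gives homotopy invariance (`pathClass_eq_of_homotopy`); applied to the
identity minus an iterated barycentric subdivision, it lets the standard simplex be replaced by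
arbitrarily small ones (`realize_sub_iterSubdivision_mem`).

It remains to kill `ℤπ₁(a,b)(ℤπ₁(a))₊^{n+1}`. This subgroup lies in the span of the products of some
`γ` with `n + 1` factors `α_j - 1`, that is, of alternating sums over the subsets of `n + 1` loops
(`altSum_cons`, `augSubmodule_le_altSpan`). Each subproduct is represented by a path that runs
through `α_j`, or rests, during a fixed time slot; the slots are separated by gaps. On an affine
simplex smaller than the gaps, each of the `n` coordinates meets at most one of the `n + 1` slots,
so some slot `j` is missed. Switching `α_j` on or off then leaves the singular simplex unchanged and
flips its sign, so the terms cancel in pairs already as chains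
(`sum_loopProduct_affineSimplex_eq_zero`).

Uniqueness and naturality hold because the path classes generate `F_n` (`FQuot_hom_ext`). -/

namespace PathHomology

/-! ### Ordered chains on a set of vertices -/

section TupleChains

variable {E E' : Type*}

/-- The free abelian group on the `k`-tuples of points of `E`: the augmented complex of ordered
simplices with vertices in `E`, shifted by one. -/
abbrev TupleChain (k : ℕ) (E : Type*) : Type _ := (Fin k → E) →₀ ℤ

/-- The alternating sum of the maps that omit one vertex. -/
noncomputable def tupleBoundary (k : ℕ) (E : Type*) : TupleChain (k + 1) E →ₗ[ℤ] TupleChain k E :=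
  ∑ i : Fin (k + 1), (-1 : ℤ) ^ (i : ℕ) •
    Finsupp.lmapDomain ℤ ℤ (fun p : Fin (k + 1) → E => p ∘ i.succAbove)

theorem tupleBoundary_single {k : ℕ} (p : Fin (k + 1) → E) (c : ℤ) :
    tupleBoundary k E (Finsupp.single p c) =
      ∑ i : Fin (k + 1), (-1 : ℤ) ^ (i : ℕ) • Finsupp.single (p ∘ i.succAbove) c := by
  simp only [tupleBoundary, LinearMap.sum_apply, LinearMap.smul_apply, Finsupp.lmapDomain_apply,
    Finsupp.mapDomain_single]

/-- The cone with apex `v`. -/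
noncomputable def cone {k : ℕ} (v : E) : TupleChain k E →ₗ[ℤ] TupleChain (k + 1) E :=
  Finsupp.lmapDomain ℤ ℤ (fun p => (Fin.cons v p : Fin (k + 1) → E))

theorem cone_single {k : ℕ} (v : E) (p : Fin k → E) (c : ℤ) :
    cone v (Finsupp.single p c) = Finsupp.single (Fin.cons v p : Fin (k + 1) → E) c := by
  simp [cone]

/-- Degree `0` is the augmentation term, spanned by the empty tuple. Nothing lies below it, so the
correction term of the general cone formula is absent. -/
theorem tupleBoundary_cone_zero (v : E) (c : TupleChain 0 E) :
    tupleBoundary 0 E (cone v c) = c := by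
  induction c using Finsupp.induction_linear with
  | zero => simp
  | add c d hc hd => rw [map_add, map_add, hc, hd]
  | single p c =>
    rw [cone_single, tupleBoundary_single]
    simp [Subsingleton.elim _ p]

/-- Omitting the apex returns `c`; omitting vertex `i + 1` of the cone is coning after omitting
vertex `i`, with the opposite sign. -/
theorem tupleBoundary_cone {k : ℕ} (v : E) (c : TupleChain (k + 1) E) :
    tupleBoundary (k + 1) E (cone v c) = c - cone v (tupleBoundary k E c) := by
  induction c using Finsupp.induction_linear with
  | zero => simp
  | add c d hc hd => simp only [map_add, hc, hd]; abel
  | single p c =>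
    rw [cone_single, tupleBoundary_single, tupleBoundary_single, Fin.sum_univ_succ, map_sum,
      sub_eq_add_neg, ← Finset.sum_neg_distrib]
    congr 1
    · rw [Fin.val_zero, pow_zero, one_smul]
      rfl
    · refine Finset.sum_congr rfl fun i _ => ?_
      rw [map_smul, cone_single, ← neg_smul, Fin.val_succ, pow_succ, mul_neg_one]
      congr 2
      funext j
      induction j using Fin.cases with
      | zero => simp
      | succ j => simp

theorem exists_cone_single {k : ℕ} (p : Fin (k + 1) → E) (c : ℤ) :
    Finsupp.single p c = cone (p 0) (Finsupp.single (Fin.tail p) c) := by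
  rw [cone_single, Fin.cons_self_tail]

/-- Every simplex is the cone over its tail from its first vertex, so the cone formula reduces the
claim to one degree lower and no simplicial identities are needed. -/
theorem tupleBoundary_tupleBoundary : ∀ (k : ℕ) (c : TupleChain (k + 2) E),
    tupleBoundary k E (tupleBoundary (k + 1) E c) = 0 := by
  intro k
  induction k with
  | zero =>
    intro c
    induction c using Finsupp.induction_linear with
    | zero => simp
    | add c d hc hd => rw [map_add, map_add, hc, hd, add_zero]
    | single p c =>
      rw [exists_cone_single, tupleBoundary_cone, map_sub, tupleBoundary_cone_zero, sub_self]
  | succ k ih =>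
    intro c
    induction c using Finsupp.induction_linear with
    | zero => simp
    | add c d hc hd => rw [map_add, map_add, hc, hd, add_zero]
    | single p c =>
      rw [exists_cone_single, tupleBoundary_cone, map_sub, tupleBoundary_cone, ih, map_zero,
        sub_zero, sub_self]

/-- The tuples with entries in `Z`. -/
def tuplesIn (k : ℕ) (Z : Set E) : Set (Fin k → E) := {p | ∀ i, p i ∈ Z}

theorem cone_mem {k : ℕ} {v : E} {S : Set (Fin k → E)} {T : Set (Fin (k + 1) → E)}
    (h : ∀ p ∈ S, (Fin.cons v p : Fin (k + 1) → E) ∈ T) {c : TupleChain k E}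
    (hc : c ∈ Finsupp.supported ℤ ℤ S) : cone v c ∈ Finsupp.supported ℤ ℤ T := by
  have : Finsupp.supported ℤ ℤ S ≤ (Finsupp.supported ℤ ℤ T).comap (cone v) := by
    rw [Finsupp.supported_eq_span_single, Submodule.span_le]
    rintro _ ⟨p, hp, rfl⟩
    rw [SetLike.mem_coe, Submodule.mem_comap, cone_single]
    exact Finsupp.single_mem_supported ℤ _ (h p hp)
  exact this hc

theorem cons_mem_tuplesIn {k : ℕ} {Z : Set E} {v : E} (hv : v ∈ Z) {p : Fin k → E}
    (hp : p ∈ tuplesIn k Z) : (Fin.cons v p : Fin (k + 1) → E) ∈ tuplesIn (k + 1) Z := by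
  intro i
  induction i using Fin.cases with
  | zero => exact hv
  | succ i => exact hp i

theorem map_mem_of_single_mem {k : ℕ} {M : Type*} [AddCommGroup M] {S : Set (Fin k → E)}
    {T : Submodule ℤ M} (d : TupleChain k E →ₗ[ℤ] M)
    (h : ∀ p ∈ S, d (Finsupp.single p 1) ∈ T) {c : TupleChain k E}
    (hc : c ∈ Finsupp.supported ℤ ℤ S) : d c ∈ T := by
  have : Finsupp.supported ℤ ℤ S ≤ T.comap d := by
    rw [Finsupp.supported_eq_span_single, Submodule.span_le]
    rintro _ ⟨p, hp, rfl⟩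
    exact h p hp
  exact this hc

theorem tupleBoundary_mem {k : ℕ} {Z : Set E} {c : TupleChain (k + 1) E}
    (hc : c ∈ Finsupp.supported ℤ ℤ (tuplesIn (k + 1) Z)) :
    tupleBoundary k E c ∈ Finsupp.supported ℤ ℤ (tuplesIn k Z) := by
  refine map_mem_of_single_mem _ (fun p hp => ?_) hc
  rw [tupleBoundary_single]
  exact Submodule.sum_mem _ fun i _ => Submodule.smul_mem _ _
    (Finsupp.single_mem_supported ℤ _ fun j => hp _)

/-! ### Contracting homotopies built from cones -/

/-- The homotopy from `d` to `0` built inductively from cones with apex `v`. -/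
noncomputable def coneHomotopy (d : ∀ k, TupleChain k E →ₗ[ℤ] TupleChain k E')
    (v : ∀ k, (Fin (k + 1) → E) → E') : ∀ k, TupleChain k E →ₗ[ℤ] TupleChain (k + 1) E'
  | 0 => 0
  | k + 1 => Finsupp.linearCombination ℤ fun p : Fin (k + 1) → E =>
      cone (v k p) (d (k + 1) (Finsupp.single p 1) -
        coneHomotopy d v k (tupleBoundary k E (Finsupp.single p 1)))

theorem coneHomotopy_single (d : ∀ k, TupleChain k E →ₗ[ℤ] TupleChain k E')
    (v : ∀ k, (Fin (k + 1) → E) → E') (k : ℕ) (p : Fin (k + 1) → E) :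
    coneHomotopy d v (k + 1) (Finsupp.single p 1) =
      cone (v k p) (d (k + 1) (Finsupp.single p 1) -
        coneHomotopy d v k (tupleBoundary k E (Finsupp.single p 1))) := by
  rw [coneHomotopy, Finsupp.linearCombination_single, one_smul]

/-- By induction, `d p` minus the homotopy of `∂p` is a cycle, and a cone over a cycle has that
cycle as boundary. The apex plays no role here; `h0` starts the induction. -/
theorem tupleBoundary_coneHomotopy (d : ∀ k, TupleChain k E →ₗ[ℤ] TupleChain k E')
    (v : ∀ k, (Fin (k + 1) → E) → E') (h0 : d 0 = 0)
    (hd : ∀ k c, tupleBoundary k E' (d (k + 1) c) = d k (tupleBoundary k E c)) (k : ℕ)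
    (c : TupleChain (k + 1) E) :
    tupleBoundary (k + 1) E' (coneHomotopy d v (k + 1) c) =
      d (k + 1) c - coneHomotopy d v k (tupleBoundary k E c) := by
  induction k with
  | zero =>
    have h : (tupleBoundary 1 E').comp (coneHomotopy d v 1) =
        d 1 - (coneHomotopy d v 0).comp (tupleBoundary 0 E) := by
      refine Finsupp.lhom_ext' fun p => LinearMap.ext_ring ?_
      simp only [LinearMap.comp_apply, Finsupp.lsingle_apply, LinearMap.sub_apply]
      rw [coneHomotopy_single, tupleBoundary_cone, map_sub, hd, h0]
      simp [coneHomotopy]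
    exact LinearMap.congr_fun h c
  | succ k ih =>
    have h : (tupleBoundary (k + 2) E').comp (coneHomotopy d v (k + 2)) =
        d (k + 2) - (coneHomotopy d v (k + 1)).comp (tupleBoundary (k + 1) E) := by
      refine Finsupp.lhom_ext' fun p => LinearMap.ext_ring ?_
      simp only [LinearMap.comp_apply, Finsupp.lsingle_apply, LinearMap.sub_apply]
      rw [coneHomotopy_single, tupleBoundary_cone, map_sub, hd, ih, tupleBoundary_tupleBoundary,
        map_zero, sub_zero, sub_self, map_zero, sub_zero]
    exact LinearMap.congr_fun h c

/-- The freedom in the apexes is spent here: if they stay in `Z'`, so does the whole homotopy. A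
single choice of apexes can serve several pairs `Z`, `Z'` at once. -/
theorem coneHomotopy_mem (d : ∀ k, TupleChain k E →ₗ[ℤ] TupleChain k E')
    (v : ∀ k, (Fin (k + 1) → E) → E') {Z : Set E} {Z' : Set E'}
    (hd : ∀ k, ∀ p ∈ tuplesIn k Z,
      d k (Finsupp.single p 1) ∈ Finsupp.supported ℤ ℤ (tuplesIn k Z'))
    (hv : ∀ k, ∀ p ∈ tuplesIn (k + 1) Z, v k p ∈ Z') (k : ℕ) {c : TupleChain k E}
    (hc : c ∈ Finsupp.supported ℤ ℤ (tuplesIn k Z)) :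
    coneHomotopy d v k c ∈ Finsupp.supported ℤ ℤ (tuplesIn (k + 1) Z') := by
  induction k with
  | zero => exact Submodule.zero_mem _
  | succ k ih =>
    refine map_mem_of_single_mem _ (fun p hp => ?_) hc
    rw [coneHomotopy_single]
    refine cone_mem (fun q hq => cons_mem_tuplesIn (hv k p hp) hq)
      (Submodule.sub_mem _ (hd _ p hp) (ih (tupleBoundary_mem ?_)))
    exact Finsupp.single_mem_supported ℤ _ hp

/-- The map of ordered chains induced by a map of vertices. -/
noncomputable def tupleMap (f : E → E') (k : ℕ) : TupleChain k E →ₗ[ℤ] TupleChain k E' :=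
  Finsupp.lmapDomain ℤ ℤ (fun p => f ∘ p)

theorem tupleMap_single (f : E → E') {k : ℕ} (p : Fin k → E) (c : ℤ) :
    tupleMap f k (Finsupp.single p c) = Finsupp.single (f ∘ p) c := by
  simp [tupleMap]

theorem tupleBoundary_tupleMap (f : E → E') (k : ℕ) (c : TupleChain (k + 1) E) :
    tupleBoundary k E' (tupleMap f (k + 1) c) = tupleMap f k (tupleBoundary k E c) := by
  induction c using Finsupp.induction_linear with
  | zero => simp
  | add c d hc hd => rw [map_add, map_add, map_add, map_add, hc, hd]
  | single p c =>
    simp only [tupleMap_single, tupleBoundary_single, map_sum, map_smul]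
    rfl

end TupleChains

/-! ### Barycentric subdivision -/

section Subdivision

variable {E : Type*} [NormedAddCommGroup E] [NormedSpace ℝ E]

/-- The barycenter of a nonempty tuple of points. -/
noncomputable def barycenter {k : ℕ} (p : Fin (k + 1) → E) : E :=
  ∑ i, ((k : ℝ) + 1)⁻¹ • p i

theorem barycenter_mem {k : ℕ} {Z : Set E} (hZ : Convex ℝ Z) {p : Fin (k + 1) → E}
    (hp : p ∈ tuplesIn (k + 1) Z) : barycenter p ∈ Z := by
  refine hZ.sum_mem (fun i _ => by positivity) ?_ fun i _ => hp i
  have : (k : ℝ) + 1 ≠ 0 := by positivity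
  simp [this]

/-- In `p j - barycenter p` the term of index `j` drops out, leaving `k` terms of norm at most `r /
(k + 1)`. The bound is relaxed to `n / (n + 1)` so that one ratio serves all dimensions up to `n`.
-/
theorem dist_barycenter_le {k n : ℕ} (hk : k ≤ n) {p : Fin (k + 1) → E} {r : ℝ} (hr : 0 ≤ r)
    (hp : ∀ i j, dist (p i) (p j) ≤ r) (j : Fin (k + 1)) :
    dist (p j) (barycenter p) ≤ n / (n + 1) * r := by
  have hk' : (k : ℝ) + 1 ≠ 0 := by positivity
  have h : p j - barycenter p = ∑ i : Fin k, ((k : ℝ) + 1)⁻¹ • (p j - p (j.succAbove i)) := by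
    have h1 : p j = ∑ i : Fin (k + 1), ((k : ℝ) + 1)⁻¹ • p j := by
      rw [Finset.sum_const, Finset.card_univ, Fintype.card_fin, ← Nat.cast_smul_eq_nsmul ℝ,
        smul_smul]
      push_cast
      rw [mul_inv_cancel₀ hk', one_smul]
    rw [barycenter]
    nth_rewrite 1 [h1]
    rw [← Finset.sum_sub_distrib, Fin.sum_univ_succAbove _ j, sub_self, zero_add]
    simp only [smul_sub]
  have hkn : (k : ℝ) / (k + 1) ≤ n / (n + 1) := by
    rw [div_le_div_iff₀ (by positivity) (by positivity)]
    have : (k : ℝ) ≤ n := by exact_mod_cast hk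
    nlinarith
  calc dist (p j) (barycenter p) = ‖∑ i : Fin k, ((k : ℝ) + 1)⁻¹ • (p j - p (j.succAbove i))‖ := by
        rw [dist_eq_norm, h]
    _ ≤ ∑ i : Fin k, ((k : ℝ) + 1)⁻¹ * r := by
        refine norm_sum_le_of_le _ fun i _ => ?_
        rw [norm_smul, Real.norm_of_nonneg (by positivity), ← dist_eq_norm]
        exact mul_le_mul_of_nonneg_left (hp _ _) (by positivity)
    _ = k / (k + 1) * r := by
        rw [Finset.sum_const, Finset.card_univ, Fintype.card_fin, nsmul_eq_mul]
        ring
    _ ≤ n / (n + 1) * r := mul_le_mul_of_nonneg_right hkn hr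

/-- Barycentric subdivision of ordered affine chains. -/
noncomputable def subdivision : ∀ k, TupleChain k E →ₗ[ℤ] TupleChain k E
  | 0 => LinearMap.id
  | k + 1 => Finsupp.linearCombination ℤ fun p : Fin (k + 1) → E =>
      cone (barycenter p) (subdivision k (tupleBoundary k E (Finsupp.single p 1)))

theorem subdivision_single {k : ℕ} (p : Fin (k + 1) → E) :
    subdivision (k + 1) (Finsupp.single p 1) =
      cone (barycenter p) (subdivision k (tupleBoundary k E (Finsupp.single p 1))) := by
  rw [subdivision, Finsupp.linearCombination_single, one_smul]

/-- By induction the subdivided boundary is a cycle, so coning it from the barycenter gives a chain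
with exactly that boundary. -/
theorem tupleBoundary_subdivision (k : ℕ) (c : TupleChain (k + 1) E) :
    tupleBoundary k E (subdivision (k + 1) c) = subdivision k (tupleBoundary k E c) := by
  induction k with
  | zero =>
    have h : (tupleBoundary 0 E).comp (subdivision 1) =
        (subdivision 0).comp (tupleBoundary 0 E) := by
      refine Finsupp.lhom_ext' fun p => LinearMap.ext_ring ?_
      simp only [LinearMap.comp_apply, Finsupp.lsingle_apply]
      rw [subdivision_single, tupleBoundary_cone_zero]
    exact LinearMap.congr_fun h c
  | succ k ih =>
    have h : (tupleBoundary (k + 1) E).comp (subdivision (k + 2)) =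
        (subdivision (k + 1)).comp (tupleBoundary (k + 1) E) := by
      refine Finsupp.lhom_ext' fun p => LinearMap.ext_ring ?_
      simp only [LinearMap.comp_apply, Finsupp.lsingle_apply]
      rw [subdivision_single, tupleBoundary_cone, ih, tupleBoundary_tupleBoundary, map_zero,
        map_zero, sub_zero]
    exact LinearMap.congr_fun h c

theorem subdivision_mem {Z : Set E} (hZ : Convex ℝ Z) (k : ℕ) {c : TupleChain k E}
    (hc : c ∈ Finsupp.supported ℤ ℤ (tuplesIn k Z)) :
    subdivision k c ∈ Finsupp.supported ℤ ℤ (tuplesIn k Z) := by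
  induction k with
  | zero => exact hc
  | succ k ih =>
    refine map_mem_of_single_mem _ (fun p hp => ?_) hc
    rw [subdivision_single]
    exact cone_mem (fun q hq => cons_mem_tuplesIn (barycenter_mem hZ hp) hq)
      (ih (tupleBoundary_mem (Finsupp.single_mem_supported ℤ _ hp)))

/-- The tuples whose points have mutual distance at most `r`. -/
def smallTuples (k : ℕ) (E : Type*) [NormedAddCommGroup E] (r : ℝ) : Set (Fin k → E) :=
  {p | ∀ i j, dist (p i) (p j) ≤ r}

theorem subdivision_small (n : ℕ) {r : ℝ} (hr : 0 ≤ r) (k : ℕ) (hk : k ≤ n + 1)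
    {c : TupleChain k E} (hc : c ∈ Finsupp.supported ℤ ℤ (smallTuples k E r)) :
    subdivision k c ∈ Finsupp.supported ℤ ℤ (smallTuples k E (n / (n + 1) * r)) := by
  induction k with
  | zero =>
    exact Finsupp.supported_mono (fun p _ i => i.elim0) hc
  | succ k ih =>
    refine map_mem_of_single_mem _ (fun p hp => ?_) hc
    rw [subdivision_single]
    -- This ball is convex and contains the vertices, hence the subdivided boundary: this bounds the
    -- distances to the new apex. The other distances are covered by induction.
    let B : Set E := Metric.closedBall (barycenter p) (n / (n + 1) * r)
    have hB : p ∈ tuplesIn (k + 1) B := fun j =>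
      Metric.mem_closedBall.2 (dist_barycenter_le (by omega) hr hp j)
    have h1 : subdivision k (tupleBoundary k E (Finsupp.single p 1)) ∈
        Finsupp.supported ℤ ℤ (tuplesIn k B ∩ smallTuples k E (n / (n + 1) * r)) := by
      rw [Finsupp.supported_inter]
      refine ⟨subdivision_mem (convex_closedBall _ _) k
        (tupleBoundary_mem (Finsupp.single_mem_supported ℤ _ hB)), ih (by omega) ?_⟩
      rw [tupleBoundary_single]
      exact Submodule.sum_mem _ fun i _ => Submodule.smul_mem _ _
        (Finsupp.single_mem_supported ℤ _ fun j j' => hp _ _)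
    refine cone_mem (fun q hq i j => ?_) h1
    have hq' : ∀ i, dist (q i) (barycenter p) ≤ n / (n + 1) * r := fun i => hq.1 i
    induction i using Fin.cases with
    | zero =>
      induction j using Fin.cases with
      | zero => simp only [Fin.cons_zero, dist_self]; positivity
      | succ j => simpa only [Fin.cons_zero, Fin.cons_succ, dist_comm] using hq' j
    | succ i =>
      induction j using Fin.cases with
      | zero => simpa only [Fin.cons_zero, Fin.cons_succ] using hq' i
      | succ j => simpa only [Fin.cons_succ] using hq.2 i j

/-- Iterated barycentric subdivision. -/
noncomputable def iterSubdivision (m k : ℕ) : TupleChain k E →ₗ[ℤ] TupleChain k E :=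
  (subdivision k) ^ m

theorem iterSubdivision_succ (m k : ℕ) (c : TupleChain k E) :
    iterSubdivision (m + 1) k c = subdivision k (iterSubdivision m k c) := by
  rw [iterSubdivision, pow_succ', Module.End.mul_apply]
  rfl

theorem tupleBoundary_iterSubdivision (m k : ℕ) (c : TupleChain (k + 1) E) :
    tupleBoundary k E (iterSubdivision m (k + 1) c) =
      iterSubdivision m k (tupleBoundary k E c) := by
  induction m with
  | zero => simp [iterSubdivision]
  | succ m ih => rw [iterSubdivision_succ, tupleBoundary_subdivision, ih, iterSubdivision_succ]

theorem iterSubdivision_zero_right (m : ℕ) (c : TupleChain 0 E) : iterSubdivision m 0 c = c := by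
  induction m with
  | zero => simp [iterSubdivision]
  | succ m ih => rw [iterSubdivision_succ, ih]; rfl

theorem iterSubdivision_mem {Z : Set E} (hZ : Convex ℝ Z) (m k : ℕ) {c : TupleChain k E}
    (hc : c ∈ Finsupp.supported ℤ ℤ (tuplesIn k Z)) :
    iterSubdivision m k c ∈ Finsupp.supported ℤ ℤ (tuplesIn k Z) := by
  induction m with
  | zero => simpa [iterSubdivision] using hc
  | succ m ih => rw [iterSubdivision_succ]; exact subdivision_mem hZ k ih

theorem iterSubdivision_small {r : ℝ} (hr : 0 ≤ r) (m n : ℕ) {c : TupleChain (n + 1) E}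
    (hc : c ∈ Finsupp.supported ℤ ℤ (smallTuples (n + 1) E r)) :
    iterSubdivision m (n + 1) c ∈
      Finsupp.supported ℤ ℤ (smallTuples (n + 1) E ((n / (n + 1) : ℝ) ^ m * r)) := by
  induction m with
  | zero => simpa [iterSubdivision] using hc
  | succ m ih =>
    rw [iterSubdivision_succ, pow_succ', mul_assoc]
    exact subdivision_small n (by positivity) _ le_rfl ih

end Subdivision

/-! ### Affine singular simplices -/

section Affine

variable {E : Type*} [NormedAddCommGroup E] [NormedSpace ℝ E]

theorem val_predAbove {n : ℕ} (i : Fin n) (k : Fin (n + 1)) :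
    (i.predAbove k : ℕ) = if (i : ℕ) < k then (k : ℕ) - 1 else k := by
  unfold Fin.predAbove
  by_cases h : (i : ℕ) < k
  · rw [dif_pos (by simpa [Fin.lt_def] using h), if_pos h, Fin.val_pred]
  · rw [dif_neg (by simpa [Fin.lt_def] using h), if_neg h, Fin.coe_castPred]

theorem val_succAbove {n : ℕ} (i : Fin (n + 1)) (j : Fin n) :
    (i.succAbove j : ℕ) = if (j : ℕ) < i then (j : ℕ) else j + 1 := by
  unfold Fin.succAbove
  by_cases h : (j : ℕ) < i
  · rw [if_pos (by simpa [Fin.lt_def] using h), if_pos h, Fin.val_castSucc]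
  · rw [if_neg (by simpa [Fin.lt_def] using h), if_neg h, Fin.val_succ]

/-- In terms of the extended sequences, the `i`-th face map just repeats the entry number `i`, end
values included. -/
theorem withEnds_face {n : ℕ} (t : Simplex n) (i : Fin (n + 2)) (k : Fin (n + 3)) :
    withEnds (0 : unitInterval) 1 (face i t).1 k = withEnds 0 1 t.1 (i.predAbove k) := by
  induction k using Fin.cases with
  | zero => simp [withEnds_zero]
  | succ k =>
    induction k using Fin.lastCases with
    | last => rw [Fin.succ_last, withEnds_last, Fin.predAbove_right_last, withEnds_last]
    | cast k =>
      rw [withEnds_mid]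
      change withEnds 0 1 t.1 (faceIndex i k) = _
      congr 1
      apply Fin.ext
      rw [val_predAbove, faceIndex]
      simp only [Fin.lt_def, Fin.val_succ, Fin.val_castSucc]
      split_ifs <;> simp only [Fin.val_succ, Fin.val_castSucc] <;> omega

/-- The barycentric coordinates of a point of `Δ^n`. -/
noncomputable def baryCoord {n : ℕ} (t : Simplex n) (j : Fin (n + 1)) : ℝ :=
  ((withEnds 0 1 t.1 j.succ : unitInterval) : ℝ) - (withEnds 0 1 t.1 j.castSucc : unitInterval)

theorem baryCoord_nonneg {n : ℕ} (t : Simplex n) (j : Fin (n + 1)) : 0 ≤ baryCoord t j :=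
  sub_nonneg.2 (Subtype.coe_le_coe.2 (withEnds_monotone t j.castSucc_le_succ))

/-- The barycentric coordinates are successive differences, so their partial sums telescope. -/
theorem sum_baryCoord_filter {n : ℕ} (t : Simplex n) (k : Fin (n + 2)) :
    ∑ j : Fin (n + 1), (if j.castSucc < k then baryCoord t j else 0) =
      withEnds (0 : unitInterval) 1 t.1 k := by
  induction k using Fin.induction with
  | zero => simp [withEnds_zero]
  | succ k ih =>
    have h : ∀ j : Fin (n + 1), (if j.castSucc < k.succ then baryCoord t j else 0) =
        (if j.castSucc < k.castSucc then baryCoord t j else 0) +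
          (if j = k then baryCoord t j else 0) := by
      intro j
      rcases lt_trichotomy j k with h | h | h
      · rw [if_pos, if_pos, if_neg h.ne, add_zero]
        · simpa using h
        · exact Fin.castSucc_lt_succ_iff.2 h.le
      · subst h; simp
      · rw [if_neg, if_neg, if_neg h.ne', add_zero]
        · simpa using h.le
        · simpa [Fin.castSucc_lt_succ_iff] using h
    rw [Finset.sum_congr rfl fun j _ => h j, Finset.sum_add_distrib, ih, Finset.sum_ite_eq',
      if_pos (Finset.mem_univ _), baryCoord]
    ring

theorem sum_baryCoord {n : ℕ} (t : Simplex n) : ∑ j, baryCoord t j = 1 := by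
  have h := sum_baryCoord_filter t (Fin.last (n + 1))
  rw [withEnds_last] at h
  simpa [Fin.castSucc_lt_last] using h

theorem continuous_withEnds {n : ℕ} (k : Fin (n + 2)) :
    Continuous fun t : Simplex n => withEnds (0 : unitInterval) 1 t.1 k := by
  induction k using Fin.cases with
  | zero => exact continuous_const
  | succ k =>
    induction k using Fin.lastCases with
    | last => simp only [Fin.succ_last, withEnds_last]; exact continuous_const
    | cast k =>
      simp only [withEnds_mid]
      exact (continuous_apply k).comp continuous_subtype_val

theorem continuous_baryCoord {n : ℕ} (j : Fin (n + 1)) :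
    Continuous fun t : Simplex n => baryCoord t j :=
  (continuous_subtype_val.comp (continuous_withEnds _)).sub
    (continuous_subtype_val.comp (continuous_withEnds _))

/-- The affine singular simplex with given vertices. -/
noncomputable def affineSimplex {n : ℕ} (p : Fin (n + 1) → E) : C(Simplex n, E) where
  toFun t := ∑ j, baryCoord t j • p j
  continuous_toFun := continuous_finsetSum _ fun j _ => (continuous_baryCoord j).smul
    continuous_const

theorem affineSimplex_apply {n : ℕ} (p : Fin (n + 1) → E) (t : Simplex n) :
    affineSimplex p t = ∑ j, baryCoord t j • p j := rfl

theorem affineSimplex_mem {n : ℕ} {Z : Set E} (hZ : Convex ℝ Z) {p : Fin (n + 1) → E}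
    (hp : p ∈ tuplesIn (n + 1) Z) (t : Simplex n) : affineSimplex p t ∈ Z :=
  hZ.sum_mem (fun j _ => baryCoord_nonneg t j) (sum_baryCoord t) fun j _ => hp j

/-- Repeating entry `i` makes barycentric coordinate `i` vanish and leaves the others unchanged up
to reindexing. -/
theorem affineSimplex_face {n : ℕ} (p : Fin (n + 2) → E) (i : Fin (n + 2)) :
    (affineSimplex p).comp (face i) = affineSimplex (p ∘ i.succAbove) := by
  ext t
  rw [ContinuousMap.comp_apply, affineSimplex_apply, affineSimplex_apply,
    Fin.sum_univ_succAbove _ i]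
  have h0 : baryCoord (face i t) i = 0 := by
    rw [baryCoord, withEnds_face, withEnds_face, Fin.predAbove_succ_self,
      Fin.predAbove_castSucc_self, sub_self]
  have h1 : ∀ j, baryCoord (face i t) (i.succAbove j) = baryCoord t j := by
    intro j
    rw [baryCoord, withEnds_face, withEnds_face, baryCoord]
    congr 4
    · apply Fin.ext
      simp only [val_predAbove, val_succAbove, Fin.val_succ]
      split_ifs <;> omega
    · apply Fin.ext
      simp only [val_predAbove, val_succAbove, Fin.val_castSucc]
      split_ifs <;> omega
  rw [h0, zero_smul, zero_add]
  simp only [h1, Function.comp_apply]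

/-- Convexity of balls is used twice: a ball about a vertex contains the simplex, hence a ball about
any point of the simplex contains all vertices, and so the simplex. -/
theorem dist_affineSimplex_le {n : ℕ} {p : Fin (n + 1) → E} {r : ℝ}
    (hp : p ∈ smallTuples (n + 1) E r) (t t' : Simplex n) :
    dist (affineSimplex p t) (affineSimplex p t') ≤ r := by
  refine affineSimplex_mem (Z := Metric.closedBall (affineSimplex p t') r)
    (convex_closedBall _ _) (fun i => ?_) t
  rw [Metric.mem_closedBall, dist_comm]
  exact affineSimplex_mem (Z := Metric.closedBall (p i) r) (convex_closedBall _ _)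
    (fun j => hp j i) t'

variable {A : Type*} [TopologicalSpace A]

/-- The singular chains obtained by composing affine simplices with a continuous map. -/
noncomputable def realize (n : ℕ) (f : C(E, A)) :
    TupleChain (n + 1) E →ₗ[ℤ] Chain n A :=
  Finsupp.lmapDomain ℤ ℤ fun p => f.comp (affineSimplex p)

theorem realize_single {n : ℕ} (f : C(E, A)) (p : Fin (n + 1) → E) (c : ℤ) :
    realize n f (Finsupp.single p c) = Finsupp.single (f.comp (affineSimplex p)) c := by
  simp [realize]

theorem boundary_realize (n : ℕ) (f : C(E, A)) (c : TupleChain (n + 2) E) :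
    boundary n A (realize (n + 1) f c) = realize n f (tupleBoundary (n + 1) E c) := by
  induction c using Finsupp.induction_linear with
  | zero => simp
  | add c d hc hd => rw [map_add, map_add, map_add, map_add, hc, hd]
  | single p c =>
    rw [realize_single, boundary_single, tupleBoundary_single, map_sum]
    refine Finset.sum_congr rfl fun i _ => ?_
    rw [map_smul, realize_single, ContinuousMap.comp_assoc, affineSimplex_face]

theorem realize_mem_subChain {n : ℕ} (f : C(E, A)) {Z : Set E} (hZ : Convex ℝ Z) {Y : Set A}
    (hf : Set.MapsTo f Z Y) {c : TupleChain (n + 1) E}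
    (hc : c ∈ Finsupp.supported ℤ ℤ (tuplesIn (n + 1) Z)) : realize n f c ∈ subChain n Y := by
  refine map_mem_of_single_mem _ (fun p hp => ?_) hc
  rw [realize_single]
  exact single_mem_subChain (fun t => hf (affineSimplex_mem hZ hp t)) 1

end Affine

/-! ### The standard simplex in `ℝ^n` and its faces -/

section Standard

/-- The vertices of `Δ^n`. -/
def stdVertex (n : ℕ) (j : Fin (n + 1)) : Fin n → ℝ := fun i => if i.castSucc < j then 0 else 1

/-- The hyperplane `x_i = x_{i+1}` in `ℝ^n`, where `x_0 = 0` and `x_{n+1} = 1`. -/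
def wall (n : ℕ) (i : Fin (n + 1)) : Set (Fin n → ℝ) :=
  {x | withEnds 0 1 x i.castSucc = withEnds 0 1 x i.succ}

/-- Unlike `withEnds_map`, source and target may live in different universes, as needed for maps
from `ℝ` to `X`. -/
theorem withEnds_comp {X : Type*} {X' : Type*} {n : ℕ} (f : X → X') (a b : X) (x : Fin n → X)
    (j : Fin (n + 2)) : withEnds (f a) (f b) (fun i => f (x i)) j = f (withEnds a b x j) := by
  induction j using Fin.cases with
  | zero => rfl
  | succ j =>
    induction j using Fin.lastCases with
    | last => rw [Fin.succ_last, withEnds_last, withEnds_last]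
    | cast j => rw [withEnds_mid, withEnds_mid]

theorem convex_wall (n : ℕ) (i : Fin (n + 1)) : Convex ℝ (wall n i) := by
  have h : ∀ (x y : Fin n → ℝ) (r s : ℝ), r + s = 1 → ∀ k,
      withEnds 0 1 (r • x + s • y) k = r * withEnds 0 1 x k + s * withEnds 0 1 y k := by
    intro x y r s hrs k
    induction k using Fin.cases with
    | zero => simp [withEnds_zero]
    | succ k =>
      induction k using Fin.lastCases with
      | last => simp [Fin.succ_last, withEnds_last, hrs]
      | cast k => simp [withEnds_mid]
  intro x hx y hy r s _ _ hrs
  change withEnds 0 1 x _ = withEnds 0 1 x _ at hx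
  change withEnds 0 1 y _ = withEnds 0 1 y _ at hy
  change withEnds 0 1 _ _ = withEnds 0 1 _ _
  rw [h x y r s hrs, h x y r s hrs, hx, hy]

theorem withEnds_stdVertex (n : ℕ) (j : Fin (n + 1)) (k : Fin (n + 2)) :
    withEnds 0 1 (stdVertex n j) k = if k ≤ j.castSucc then 0 else 1 := by
  induction k using Fin.cases with
  | zero => simp [withEnds_zero]
  | succ k =>
    induction k using Fin.lastCases with
    | last =>
      rw [Fin.succ_last, withEnds_last, if_neg]
      simpa [Fin.le_def] using Nat.le_of_lt_succ j.isLt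
    | cast k =>
      rw [withEnds_mid, stdVertex]
      simp [Fin.le_def, Fin.lt_def]

/-- The extended sequence of vertex `j` jumps from `0` to `1` only between positions `j` and `j +
1`. -/
theorem stdVertex_mem_wall (n : ℕ) (i j : Fin (n + 1)) (h : j ≠ i) :
    stdVertex n j ∈ wall n i := by
  change withEnds 0 1 _ _ = withEnds 0 1 _ _
  rw [withEnds_stdVertex, withEnds_stdVertex]
  have h' : (j : ℕ) ≠ i := fun e => h (Fin.ext e)
  simp only [Fin.le_def, Fin.val_castSucc, Fin.val_succ]
  congr 1
  apply propext
  omega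

theorem affineSimplex_stdVertex (n : ℕ) (t : Simplex n) (i : Fin n) :
    affineSimplex (stdVertex n) t i = t.1 i := by
  rw [affineSimplex_apply, Finset.sum_apply]
  have h := sum_baryCoord_filter t i.castSucc.succ
  rw [withEnds_mid] at h
  rw [← h]
  refine Finset.sum_congr rfl fun j _ => ?_
  rw [Pi.smul_apply, stdVertex, smul_eq_mul]
  rcases le_or_gt j i.castSucc with hj | hj
  · rw [if_neg hj.not_gt, if_pos (Fin.castSucc_lt_succ_iff.2 hj), mul_one]
  · rw [if_pos hj, if_neg, mul_zero]
    simpa [Fin.castSucc_lt_succ_iff] using hj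

theorem stdVertex_mem_smallTuples (n : ℕ) : stdVertex n ∈ smallTuples (n + 1) (Fin n → ℝ) 1 := by
  intro i j
  refine (dist_pi_le_iff zero_le_one).2 fun k => ?_
  unfold stdVertex
  split_ifs <;> simp

/-- A chain map `d` that vanishes on the augmentation and respects the walls sends the standard
simplex to a relative boundary. -/
theorem realize_stdVertex_mem {E : Type*} [NormedAddCommGroup E] [NormedSpace ℝ E] {A : Type*}
    [TopologicalSpace A] {n : ℕ} (f : C(E, A)) {Y : Set A}
    (d : ∀ k, TupleChain k (Fin n → ℝ) →ₗ[ℤ] TupleChain k E) (h0 : d 0 = 0)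
    (hd : ∀ k c, tupleBoundary k E (d (k + 1) c) = d k (tupleBoundary k _ c))
    (v : (Fin n → ℝ) → E) (W : Fin (n + 1) → Set E) (hW : ∀ i, Convex ℝ (W i))
    (hv : ∀ i, Set.MapsTo v (wall n i) (W i)) (hf : ∀ i, Set.MapsTo f (W i) Y)
    (hdW : ∀ i k, ∀ p ∈ tuplesIn k (wall n i),
      d k (Finsupp.single p 1) ∈ Finsupp.supported ℤ ℤ (tuplesIn k (W i))) :
    realize n f (d (n + 1) (Finsupp.single (stdVertex n) 1)) ∈
      subChain n Y ⊔ LinearMap.range (boundary n A) := by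
  -- With apex `v (p 0)`, a tuple on the wall `i` gets an apex in `W i`, for every `i`
  -- simultaneously.
  have h := tupleBoundary_coneHomotopy d (fun k p => v (p 0)) h0 hd n
    (Finsupp.single (stdVertex n) 1)
  rw [eq_sub_iff_add_eq'] at h
  rw [← h, map_add]
  refine Submodule.add_mem_sup ?_ ⟨_, boundary_realize n f _⟩
  -- The error term is the homotopy applied to the faces of the standard simplex. Face `i` omits
  -- vertex `i`, so it lies on wall `i`, and its contribution is a chain of `Y`.
  rw [tupleBoundary_single, map_sum, map_sum]
  refine Submodule.sum_mem _ fun i _ => ?_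
  rw [map_smul, map_smul]
  refine Submodule.smul_mem _ _ (realize_mem_subChain f (hW i) (hf i) ?_)
  refine coneHomotopy_mem d _ (hdW i) (fun k p hp => hv i (hp 0)) n ?_
  exact Finsupp.single_mem_supported ℤ _ fun j => stdVertex_mem_wall n i _ (Fin.succAbove_ne i j)

end Standard

/-! ### Homotopy invariance of the class of a path -/

section HomotopyInvariance

/-- The retraction of the real line onto the unit interval. -/
noncomputable def clamp (x : ℝ) : unitInterval := Set.projIcc 0 1 zero_le_one x

theorem continuous_clamp : Continuous clamp :=
  continuous_projIcc (h := zero_le_one)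

theorem clamp_coe (t : unitInterval) : clamp t = t := Set.projIcc_val _ t

theorem clamp_zero : clamp 0 = 0 := clamp_coe 0

theorem clamp_one : clamp 1 = 1 := clamp_coe 1

theorem withEnds_clamp {X : Type u} {a b : X} {n : ℕ} (g : unitInterval → X) (h0 : g 0 = a) (h1 : g 1 = b)
    (x : Fin n → ℝ) (k : Fin (n + 2)) :
    withEnds a b (fun i => g (clamp (x i))) k = g (clamp (withEnds 0 1 x k)) := by
  have h := withEnds_comp (fun y : ℝ => g (clamp y)) 0 1 x k
  rwa [clamp_zero, clamp_one, h0, h1] at h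

/-- Stated for a bare function with prescribed end values, so that it applies both to a path and to
each stage of a homotopy of paths. -/
theorem clamp_mem_diagSet {X : Type u} {a b : X} {n : ℕ} (g : unitInterval → X) (h0 : g 0 = a) (h1 : g 1 = b)
    {i : Fin (n + 1)} {x : Fin n → ℝ} (hx : x ∈ wall n i) :
    (fun i => g (clamp (x i))) ∈ diagSet n a b := by
  refine Set.mem_iUnion.2 ⟨i, ?_⟩
  change withEnds a b _ _ = withEnds a b _ _
  rw [withEnds_clamp g h0 h1, withEnds_clamp g h0 h1, show withEnds 0 1 x _ = _ from hx]

variable {X : Type u} [TopologicalSpace X] {a b : X}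

/-- The map `ℝ^n → X^n` that extends `γ^{(n)}`. -/
noncomputable def pathPow (n : ℕ) (γ : Path a b) : C(Fin n → ℝ, Fin n → X) where
  toFun x i := γ (clamp (x i))
  continuous_toFun := continuous_pi fun i =>
    γ.continuous.comp (continuous_clamp.comp (continuous_apply i))

theorem pathPow_comp_affineSimplex (n : ℕ) (γ : Path a b) :
    (pathPow n γ).comp (affineSimplex (stdVertex n)) = pathSimplex n γ := by
  ext t i
  change γ (clamp (affineSimplex (stdVertex n) t i)) = γ (t.1 i)
  rw [affineSimplex_stdVertex, clamp_coe]

theorem pathPow_mapsTo (n : ℕ) (γ : Path a b) (i : Fin (n + 1)) :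
    Set.MapsTo (pathPow n γ) (wall n i) (diagSet n a b) :=
  fun _ hx => clamp_mem_diagSet γ γ.source γ.target hx

/-- Reduces relations in relative homology to absolute chains, so that the quotient complex can be
avoided afterwards. -/
theorem sum_pathClass_eq_zero {ι : Type*} [Fintype ι] {n : ℕ} (z : ι → ℤ) (γ : ι → Path a b)
    (h : ∑ i, z i • Finsupp.single (pathSimplex n (γ i)) (1 : ℤ) ∈
      subChain n (diagSet n a b) ⊔ LinearMap.range (boundary n (Fin n → X))) :
    ∑ i, z i • pathClass n (γ i) = 0 := by
  let c : ι → relCycles n (diagSet n a b) := fun i => ⟨_, pathSimplex_mem_relCycles n (γ i)⟩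
  have h1 : ∑ i, z i • pathClass n (γ i) = Submodule.Quotient.mk (∑ i, z i • c i) := by
    rw [← Submodule.mkQ_apply, map_sum]
    simp only [map_smul]
    rfl
  rw [h1, Submodule.Quotient.mk_eq_zero]
  obtain ⟨y, hy, _, ⟨w, rfl⟩, hyw⟩ := Submodule.mem_sup.1 h
  refine ⟨(subChain (n + 1) (diagSet n a b)).mkQ w, ?_⟩
  have h2 : ((∑ i, z i • c i : relCycles n (diagSet n a b)) : RelChain n (diagSet n a b)) =
      (subChain n (diagSet n a b)).mkQ
        (∑ i, z i • Finsupp.single (pathSimplex n (γ i)) (1 : ℤ)) := by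
    rw [map_sum, Submodule.coe_sum]
    simp only [map_smul]
    rfl
  change relBoundary n _ _ = ((∑ i, z i • c i : relCycles n (diagSet n a b)) :
    RelChain n (diagSet n a b))
  rw [h2, ← hyw, map_add, (Submodule.Quotient.mk_eq_zero _).2 hy |> fun e =>
    show (subChain n (diagSet n a b)).mkQ y = 0 from e, zero_add, relBoundary,
    Submodule.mkQ_apply, Submodule.mapQ_apply]
  rfl

theorem affineSimplex_prodMk {n : ℕ} (s : ℝ) (t : Simplex n) :
    affineSimplex ((fun x => (x, s)) ∘ stdVertex n) t = (affineSimplex (stdVertex n) t, s) := by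
  refine Prod.ext ?_ ?_
  · simp only [affineSimplex_apply, Prod.fst_sum, Function.comp_apply, Prod.smul_fst]
  · simp only [affineSimplex_apply, Prod.snd_sum, Function.comp_apply, Prod.smul_snd,
      smul_eq_mul, ← Finset.sum_mul, sum_baryCoord, one_mul]

/-- The cone homotopy in the convex space `ℝ^n × ℝ` takes the place of the prism operator. All
coordinates share one time parameter, so equal neighbouring coordinates stay equal. -/
theorem pathClass_eq_of_homotopy (n : ℕ) {γ γ' : Path a b} (F : Path.Homotopy γ γ') :
    pathClass n γ = pathClass n γ' := by
  let f : C((Fin n → ℝ) × ℝ, Fin n → X) :=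
    { toFun x i := F (clamp x.2, clamp (x.1 i))
      continuous_toFun := continuous_pi fun i => F.continuous.comp
        ((continuous_clamp.comp continuous_snd).prodMk
          (continuous_clamp.comp ((continuous_apply i).comp continuous_fst))) }
  let d : ∀ k, TupleChain k (Fin n → ℝ) →ₗ[ℤ] TupleChain k ((Fin n → ℝ) × ℝ) := fun k =>
    tupleMap (fun x => (x, (0 : ℝ))) k - tupleMap (fun x => (x, (1 : ℝ))) k
  have hmem := realize_stdVertex_mem (n := n) f (Y := diagSet n a b) d
    (by
      -- Both ends induce the same map on the empty tuple, so their difference vanishes on the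
      -- augmentation term.
      refine Finsupp.lhom_ext fun p c => ?_
      simp only [d, LinearMap.sub_apply, tupleMap_single, LinearMap.zero_apply, sub_eq_zero]
      rw [Subsingleton.elim ((fun x => (x, (0 : ℝ))) ∘ p) ((fun x => (x, (1 : ℝ))) ∘ p)])
    (fun k c => by simp only [d, LinearMap.sub_apply, map_sub, tupleBoundary_tupleMap])
    (fun x => (x, 0)) (fun i => Prod.fst ⁻¹' wall n i)
    (fun i => (convex_wall n i).linear_preimage (LinearMap.fst ℝ _ _))
    (fun i x hx => hx)
    -- Fixed endpoints matter here: each stage of `F` still runs from `a` to `b`.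
    (fun i x hx => clamp_mem_diagSet (fun t => F (clamp x.2, t)) (F.source _) (F.target _) hx)
    (fun i k p hp => by
      simp only [d, LinearMap.sub_apply, tupleMap_single]
      exact Submodule.sub_mem _ (Finsupp.single_mem_supported ℤ _ fun j => hp j)
        (Finsupp.single_mem_supported ℤ _ fun j => hp j))
  have h0 : f.comp (affineSimplex ((fun x => (x, (0 : ℝ))) ∘ stdVertex n)) = pathSimplex n γ := by
    ext t i
    rw [ContinuousMap.comp_apply, affineSimplex_prodMk]
    change F (clamp 0, clamp (affineSimplex (stdVertex n) t i)) = γ (t.1 i)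
    rw [affineSimplex_stdVertex, clamp_coe, clamp_zero]
    exact F.apply_zero _
  have h1 : f.comp (affineSimplex ((fun x => (x, (1 : ℝ))) ∘ stdVertex n)) = pathSimplex n γ' := by
    ext t i
    rw [ContinuousMap.comp_apply, affineSimplex_prodMk]
    change F (clamp 1, clamp (affineSimplex (stdVertex n) t i)) = γ' (t.1 i)
    rw [affineSimplex_stdVertex, clamp_coe, clamp_one]
    exact F.apply_one _
  simp only [d, LinearMap.sub_apply, tupleMap_single, map_sub, realize_single, h0, h1] at hmem
  have h := sum_pathClass_eq_zero (n := n) ![1, -1] ![γ, γ'] (by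
    simpa [Fin.sum_univ_two, sub_eq_add_neg] using hmem)
  simpa [Fin.sum_univ_two, ← sub_eq_add_neg, sub_eq_zero] using h

theorem realize_sub_iterSubdivision_mem (n m : ℕ) (γ : Path a b) :
    realize n (pathPow n γ) (Finsupp.single (stdVertex n) 1 -
        iterSubdivision m (n + 1) (Finsupp.single (stdVertex n) 1)) ∈
      subChain n (diagSet n a b) ⊔ LinearMap.range (boundary n (Fin n → X)) := by
  let d : ∀ k, TupleChain k (Fin n → ℝ) →ₗ[ℤ] TupleChain k (Fin n → ℝ) :=
    fun k => LinearMap.id - iterSubdivision m k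
  have hd : ∀ k c, d k c = c - iterSubdivision m k c := fun k c => rfl
  rw [← hd]
  refine realize_stdVertex_mem (pathPow n γ) d ?_ ?_ id (wall n) (convex_wall n)
    (fun i => Set.mapsTo_id _) (pathPow_mapsTo n γ) ?_
  · refine LinearMap.ext fun x => ?_
    rw [hd, iterSubdivision_zero_right, sub_self, LinearMap.zero_apply]
  · intro k x
    rw [hd, hd, map_sub, tupleBoundary_iterSubdivision]
  · intro i k p hp
    rw [hd]
    have hp' := Finsupp.single_mem_supported ℤ (1 : ℤ) hp
    exact Submodule.sub_mem _ hp' (iterSubdivision_mem (convex_wall n i) m k hp')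

/-- A combination of path classes vanishes if the corresponding combination of singular simplices
vanishes on every sufficiently small affine simplex. -/
theorem sum_pathClass_eq_zero_of_small {ι : Type*} [Fintype ι] {n : ℕ} (z : ι → ℤ)
    (γ : ι → Path a b) {ρ : ℝ} (hρ : 0 < ρ)
    (h : ∀ r < ρ, ∀ p ∈ smallTuples (n + 1) (Fin n → ℝ) r,
      ∑ e, z e • Finsupp.single ((pathPow n (γ e)).comp (affineSimplex p)) (1 : ℤ) = 0) :
    ∑ e, z e • pathClass n (γ e) = 0 := by
  -- Each subdivision shrinks diameters by `n / (n + 1) < 1`, starting from the bound `1` for the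
  -- standard simplex in the sup norm.
  obtain ⟨m, hm⟩ : ∃ m : ℕ, (n / (n + 1) : ℝ) ^ m < ρ := by
    refine exists_pow_lt_of_lt_one hρ ?_
    rw [div_lt_one (by positivity)]
    linarith
  -- All paths are evaluated on one and the same subdivided chain of `ℝ^n`, so cancellation can be
  -- checked one small simplex at a time.
  let D : TupleChain (n + 1) (Fin n → ℝ) →ₗ[ℤ] Chain n (Fin n → X) :=
    ∑ e, z e • realize n (pathPow n (γ e))
  have hD : ∀ c, D c = ∑ e, z e • realize n (pathPow n (γ e)) c := fun c => by
    rw [LinearMap.sum_apply]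
    rfl
  have hzero : D (iterSubdivision m (n + 1) (Finsupp.single (stdVertex n) 1)) = 0 := by
    rw [← Submodule.mem_bot ℤ]
    refine map_mem_of_single_mem D (fun p hp => ?_) (iterSubdivision_small zero_le_one m n
      (Finsupp.single_mem_supported ℤ 1 (stdVertex_mem_smallTuples n)))
    rw [Submodule.mem_bot, hD]
    simp only [realize_single]
    exact h _ (by rwa [mul_one]) p hp
  have hc : ∑ e, z e • Finsupp.single (pathSimplex n (γ e)) (1 : ℤ) =
      D (Finsupp.single (stdVertex n) 1) := by
    rw [hD]
    refine Finset.sum_congr rfl fun e _ => ?_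
    rw [realize_single, pathPow_comp_affineSimplex]
  refine sum_pathClass_eq_zero z γ ?_
  rw [hc, ← sub_zero (D _), ← hzero, ← map_sub, hD]
  exact Submodule.sum_mem _ fun e _ => Submodule.smul_mem _ _
    (realize_sub_iterSubdivision_mem n m (γ e))

end HomotopyInvariance

/-! ### Products with loops placed on separated intervals -/

section LoopProduct

variable {X : Type u} [TopologicalSpace X] {a b : X}

/-- The path that runs through the loops `s 0, …, s (m - 1)`, each followed by a pause, and
then through `γ`. -/
noncomputable def loopProduct (γ : Path a b) : ∀ m, (Fin m → Path a a) → Path a b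
  | 0, _ => γ
  | m + 1, s => (s 0).trans ((Path.refl a).trans (loopProduct γ m fun j => s j.succ))

/-- The interval on which `loopProduct` runs through the loop number `j`. -/
def slot (j : ℕ) : Set ℝ := Set.Icc (1 - (1 / 4) ^ j) (1 - (1 / 4) ^ j / 2)

/-- The pauses in `loopProduct` create the gaps: between slots `j` and `j + 1` the gap is
`(1/4)^(j+1)`, and `j + 1 ≤ n` when `j` is the smaller of two indices. -/
theorem slot_separated {n j j' : ℕ} (hj : j ≤ n) (hj' : j' ≤ n) (h : j ≠ j') {x y : ℝ}
    (hx : x ∈ slot j) (hy : y ∈ slot j') : (1 / 4) ^ n ≤ |x - y| := by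
  wlog hlt : j < j' generalizing j j' x y
  · rw [abs_sub_comm]
    exact this hj' hj h.symm hy hx (by omega)
  have h1 : (1 / 4 : ℝ) ^ j' ≤ (1 / 4) ^ (j + 1) :=
    pow_le_pow_of_le_one (by norm_num) (by norm_num) hlt
  have h2 : (1 / 4 : ℝ) ^ n ≤ (1 / 4) ^ (j + 1) :=
    pow_le_pow_of_le_one (by norm_num) (by norm_num) (by omega)
  rw [pow_succ] at h1 h2
  have := hx.2
  have := hy.1
  rw [abs_sub_comm]
  refine le_trans ?_ (le_abs_self _)
  linarith

theorem loopProduct_eq_of_notMem (γ : Path a b) (m : ℕ) (s s' : Fin m → Path a a) (j : Fin m)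
    (h : ∀ k, k ≠ j → s k = s' k) (t : unitInterval) (ht : (t : ℝ) ∉ slot j) :
    loopProduct γ m s t = loopProduct γ m s' t := by
  induction m generalizing t with
  | zero => exact j.elim0
  | succ m ih =>
    have ht0 := t.2.1
    simp only [loopProduct, Path.trans_apply]
    split_ifs with h1 h2
    · induction j using Fin.cases with
      | zero =>
        exfalso
        refine ht ⟨?_, ?_⟩
        · simpa using ht0
        · simp only [Fin.val_zero, pow_zero]; linarith
      | succ j => rw [h 0 (Fin.succ_ne_zero j).symm]
    · rfl
    · induction j using Fin.cases with
      | zero =>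
        have : (fun j : Fin m => s j.succ) = fun j => s' j.succ :=
          funext fun k => h _ (Fin.succ_ne_zero k)
        rw [this]
      | succ j =>
        -- The tail is run through in the time `4t - 3`, which carries slot `j + 1` onto slot `j`.
        refine ih _ _ j (fun k hk => h _ fun e => hk (Fin.succ_injective _ e)) _ fun hmem => ht ?_
        simp only [slot, Set.mem_Icc, Fin.val_succ, pow_succ] at hmem ⊢
        constructor <;> linarith [hmem.1, hmem.2]

/-- The sign attached to keeping (`true`) or omitting (`false`) a factor. -/
def boolSign (e : Bool) : ℤ := if e then 1 else -1

/-- The loops `α j` with `e j = true`, the others being replaced by the constant loop. -/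
def pickLoops {m : ℕ} (α : Fin m → Path a a) (e : Fin m → Bool) (j : Fin m) : Path a a :=
  if e j then α j else Path.refl a

theorem sum_loopProduct_affineSimplex_eq_zero {n : ℕ} (γ : Path a b) (α : Fin (n + 1) → Path a a)
    {r : ℝ} (hr : r < (1 / 4) ^ n) {p : Fin (n + 1) → Fin n → ℝ}
    (hp : p ∈ smallTuples (n + 1) (Fin n → ℝ) r) :
    ∑ e : Fin (n + 1) → Bool, (∏ j, boolSign (e j)) •
      Finsupp.single ((pathPow n (loopProduct γ (n + 1) (pickLoops α e))).comp (affineSimplex p))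
        (1 : ℤ) = 0 := by
  -- Pigeonhole: if every slot were visited, two of the `n + 1` slots would be visited by the same
  -- one of the `n` coordinates. Clamping does not increase distances, so that coordinate would have
  -- to vary by at least the gap.
  obtain ⟨j, hj⟩ : ∃ j : Fin (n + 1), ∀ (i : Fin n) (t : Simplex n),
      (clamp (affineSimplex p t i) : ℝ) ∉ slot j := by
    by_contra! hcon
    choose i t hit using hcon
    have hinj : Function.Injective i := by
      intro j j' hjj
      by_contra hne
      have h1 := slot_separated (n := n) (by omega) (by omega) (fun e => hne (Fin.ext e))
        (hit j) (hit j')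
      have h2 := Set.abs_projIcc_sub_projIcc (a := (0 : ℝ)) (b := 1) (c := affineSimplex p (t j) (i j))
        (d := affineSimplex p (t j') (i j')) zero_le_one
      have h3 : |affineSimplex p (t j) (i j) - affineSimplex p (t j') (i j')| ≤ r := by
        rw [hjj, ← Real.dist_eq]
        exact (dist_le_pi_dist _ _ _).trans (dist_affineSimplex_le hp _ _)
      have h4 := h1.trans (h2.trans h3)
      linarith
    simpa using Fintype.card_le_of_injective i hinj
  -- Toggling the loop of the missed slot pairs off terms with equal simplices and opposite signs.
  refine Finset.sum_involution (fun e _ => Function.update e j (!e j)) ?_ ?_ ?_ ?_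
  · intro e _
    have hpath : (pathPow n (loopProduct γ (n + 1)
          (pickLoops α (Function.update e j (!e j))))).comp (affineSimplex p) =
        (pathPow n (loopProduct γ (n + 1) (pickLoops α e))).comp (affineSimplex p) := by
      ext t i
      refine loopProduct_eq_of_notMem γ _ _ _ j (fun k hk => ?_) _ (hj i t)
      rw [pickLoops, pickLoops, Function.update_of_ne hk]
    have hsign : ∏ k, boolSign (Function.update e j (!e j) k) = -∏ k, boolSign (e k) := by
      rw [Fin.prod_univ_succAbove _ j, Fin.prod_univ_succAbove (fun k => boolSign (e k)) j,
        Function.update_self, ← neg_mul]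
      congr 1
      · cases e j <;> rfl
      · exact Finset.prod_congr rfl fun k _ => by
          rw [Function.update_of_ne (Fin.succAbove_ne j k)]
    rw [hpath, hsign, neg_smul, add_neg_cancel]
  · intro e _ _ he
    have := congrFun he j
    simp at this
  · intro e _
    exact Finset.mem_univ _
  · intro e _
    simp

/-- The alternating sum over the subproducts of `n + 1` loops has class zero. -/
theorem sum_loopProduct_pathClass_eq_zero {n : ℕ} (γ : Path a b) (α : Fin (n + 1) → Path a a) :
    ∑ e : Fin (n + 1) → Bool, (∏ j, boolSign (e j)) •
      pathClass n (loopProduct γ (n + 1) (pickLoops α e)) = 0 :=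
  sum_pathClass_eq_zero_of_small _ _ (by positivity) fun _ hr _ hp =>
    sum_loopProduct_affineSimplex_eq_zero γ α hr hp

end LoopProduct

/-! ### Generators of the powers of the augmentation ideal -/

section Generators

variable {X : Type u} [TopologicalSpace X] {a b : X}

theorem trans_assoc {x y z w : X} (p : Path.Homotopic.Quotient x y)
    (q : Path.Homotopic.Quotient y z) (r : Path.Homotopic.Quotient z w) :
    (p.trans q).trans r = p.trans (q.trans r) := by
  obtain ⟨p, rfl⟩ := Path.Homotopic.Quotient.mk_surjective p
  obtain ⟨q, rfl⟩ := Path.Homotopic.Quotient.mk_surjective q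
  obtain ⟨r, rfl⟩ := Path.Homotopic.Quotient.mk_surjective r
  exact Path.Homotopic.Quotient.eq.2 ⟨Path.Homotopy.transAssoc p q r⟩

theorem refl_trans {x y : X} (p : Path.Homotopic.Quotient x y) :
    (Path.Homotopic.Quotient.refl x).trans p = p := by
  obtain ⟨p, rfl⟩ := Path.Homotopic.Quotient.mk_surjective p
  exact Path.Homotopic.Quotient.eq.2 ⟨Path.Homotopy.reflTrans p⟩

theorem rightAction_one (x : PathModule a b) : rightAction a b x 1 = x := by
  induction x using Finsupp.induction_linear with
  | zero => simp
  | add x y hx hy => rw [map_add, LinearMap.add_apply, hx, hy]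
  | single γ c =>
    rw [MonoidAlgebra.one_def, rightAction_single, mul_one]
    exact congrArg (fun γ => Finsupp.single γ c) (refl_trans γ)

/-- Since `α β` means `β` followed by `α`, this is associativity of concatenation. -/
theorem rightAction_mul (x : PathModule a b) (y z : GroupRing a) :
    rightAction a b x (y * z) = rightAction a b (rightAction a b x y) z := by
  induction x using Finsupp.induction_linear with
  | zero => simp
  | add x x' hx hx' => simp only [map_add, LinearMap.add_apply, hx, hx']
  | single γ c =>
    induction y using MonoidAlgebra.induction_linear with
    | zero => simp
    | add y y' hy hy' => simp only [add_mul, map_add, LinearMap.add_apply, hy, hy']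
    | single α d =>
      induction z using MonoidAlgebra.induction_linear with
      | zero => simp
      | add z z' hz hz' => simp only [mul_add, map_add, hz, hz']
      | single β e =>
        rw [MonoidAlgebra.single_mul_single, rightAction_single, rightAction_single,
          rightAction_single, mul_assoc]
        exact congrArg (fun γ => Finsupp.single γ (c * (d * e))) (trans_assoc _ _ _)

/-- The alternating sum of the classes of the subproducts of given loops, followed by `γ`. -/
noncomputable def altSum {m : ℕ} (γ : Path a b) (α : Fin m → Path a a) : PathModule a b :=
  ∑ e : Fin m → Bool, (∏ j, boolSign (e j)) •
    Finsupp.single (Path.Homotopic.Quotient.mk (loopProduct γ m (pickLoops α e))) 1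

theorem mk_loopProduct_cons {m : ℕ} (γ : Path a b) (β : Path a a) (s : Fin m → Path a a) :
    Path.Homotopic.Quotient.mk (loopProduct γ (m + 1) (Fin.cons β s)) =
      (Path.Homotopic.Quotient.mk β).trans (Path.Homotopic.Quotient.mk (loopProduct γ m s)) := by
  change Path.Homotopic.Quotient.mk (β.trans ((Path.refl a).trans (loopProduct γ m s))) = _
  rw [Path.Homotopic.Quotient.mk_trans, Path.Homotopic.Quotient.mk_trans,
    Path.Homotopic.Quotient.mk_refl, refl_trans]

theorem pickLoops_cons {m : ℕ} (β : Path a a) (α : Fin m → Path a a) (x : Bool)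
    (e : Fin m → Bool) :
    pickLoops (Fin.cons β α) (Fin.cons x e) =
      Fin.cons (if x then β else Path.refl a) (pickLoops α e) := by
  funext j
  induction j using Fin.cases with
  | zero => simp [pickLoops]
  | succ j => simp [pickLoops]

/-- Splitting the sum according to the first loop: keeping `β` gives the action of `β`, omitting it
gives the action of `-1`. Iterating, an alternating sum is `γ` times a product of factors `α_j - 1`;
the pauses disappear up to homotopy. -/
theorem altSum_cons {m : ℕ} (γ : Path a b) (β : Path a a) (α : Fin m → Path a a) :
    altSum γ (Fin.cons β α) = rightAction a b (altSum γ α)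
      (MonoidAlgebra.single (FundamentalGroup.fromPath (Path.Homotopic.Quotient.mk β)) 1 - 1) := by
  rw [map_sub, rightAction_one, altSum, altSum,
    ← (Fin.consEquiv fun _ : Fin (m + 1) => Bool).sum_comp, Fintype.sum_prod_type,
    Fintype.sum_bool, sub_eq_add_neg, ← Finset.sum_neg_distrib, map_sum, LinearMap.sum_apply]
  congr 1
  · refine Finset.sum_congr rfl fun e _ => ?_
    rw [map_smul, LinearMap.smul_apply, rightAction_single, mul_one, Fin.prod_univ_succ]
    change (boolSign true * ∏ j, boolSign (e j)) • Finsupp.single (Path.Homotopic.Quotient.mk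
      (loopProduct γ (m + 1) (pickLoops (Fin.cons β α) (Fin.cons true e)))) (1 : ℤ) = _
    rw [pickLoops_cons, mk_loopProduct_cons, if_pos rfl, boolSign, if_pos rfl, one_mul]
  · refine Finset.sum_congr rfl fun e _ => ?_
    rw [Fin.prod_univ_succ]
    change (boolSign false * ∏ j, boolSign (e j)) • Finsupp.single (Path.Homotopic.Quotient.mk
      (loopProduct γ (m + 1) (pickLoops (Fin.cons β α) (Fin.cons false e)))) (1 : ℤ) = _
    rw [pickLoops_cons, mk_loopProduct_cons, if_neg Bool.false_ne_true,
      Path.Homotopic.Quotient.mk_refl, refl_trans, boolSign, if_neg Bool.false_ne_true,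
      neg_one_mul, neg_smul]

/-- The subgroup generated by the alternating sums over `m` loops. -/
noncomputable def altSpan (m : ℕ) (a b : X) : Submodule ℤ (PathModule a b) :=
  Submodule.span ℤ {x | ∃ (γ : Path a b) (α : Fin m → Path a a), x = altSum γ α}

theorem rightAction_mem_altSpan {m : ℕ} {x : PathModule a b} (hx : x ∈ altSpan m a b)
    {y : GroupRing a} (hy : y ∈ augIdeal a) : rightAction a b x y ∈ altSpan (m + 1) a b := by
  -- The projection `z ↦ z - ε(z)` fixes the augmentation ideal and is linear on the whole group
  -- ring, so it suffices to test it on group elements, where it yields multiples of `α - 1`.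
  have key : ∀ z : GroupRing a,
      rightAction a b x (z - augmentation a z • 1) ∈ altSpan (m + 1) a b := by
    intro z
    induction z using MonoidAlgebra.induction_linear with
    | zero => simp
    | add z w hz hw =>
      rw [map_add, add_smul, add_sub_add_comm, map_add]
      exact Submodule.add_mem _ hz hw
    | single α c =>
      have hα : (MonoidAlgebra.single α c : GroupRing a) -
          augmentation a (MonoidAlgebra.single α c) • 1 =
            c • (MonoidAlgebra.single α 1 - 1 : GroupRing a) := by
        have h1 : augmentation a (MonoidAlgebra.single α c) = c := by simp [augmentation]
        rw [h1, smul_sub, MonoidAlgebra.smul_single, smul_eq_mul, mul_one]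
      rw [hα, map_smul]
      refine Submodule.smul_mem _ _ ?_
      obtain ⟨β, hβ⟩ := Path.Homotopic.Quotient.mk_surjective α.toPath
      induction hx using Submodule.span_induction with
      | mem x hx =>
        obtain ⟨γ, s, rfl⟩ := hx
        refine Submodule.subset_span ⟨γ, Fin.cons β s, ?_⟩
        rw [altSum_cons, hβ]
      | zero => simp
      | add x x' _ _ hx hx' =>
        rw [map_add, LinearMap.add_apply]
        exact Submodule.add_mem _ hx hx'
      | smul d x _ hx =>
        rw [map_smul, LinearMap.smul_apply]
        exact Submodule.smul_mem _ _ hx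
  have h := key y
  rwa [show augmentation a y = 0 from hy, zero_smul, sub_zero] at h

theorem altSpan_zero : altSpan 0 a b = ⊤ := by
  refine eq_top_iff.2 fun x _ => ?_
  induction x using Finsupp.induction_linear with
  | zero => exact Submodule.zero_mem _
  | add x y hx hy => exact Submodule.add_mem _ (hx trivial) (hy trivial)
  | single γ c =>
    obtain ⟨γ, rfl⟩ := Path.Homotopic.Quotient.mk_surjective γ
    rw [← mul_one c, ← smul_eq_mul, ← Finsupp.smul_single]
    refine Submodule.smul_mem _ _ (Submodule.subset_span ⟨γ, Fin.elim0, ?_⟩)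
    rw [altSum, Fintype.sum_unique, Finset.univ_eq_empty, Finset.prod_empty, one_smul]
    rfl

/-- Peeling off the last factor of the power adds one loop to the alternating sums. Only this
inclusion is needed. -/
theorem augSubmodule_le_altSpan (m : ℕ) (a b : X) : augSubmodule m a b ≤ altSpan m a b := by
  refine Submodule.map₂_le.2 fun x _ y hy => ?_
  induction m generalizing x y with
  | zero =>
    rw [altSpan_zero]
    trivial
  | succ m ih =>
    rw [pow_succ] at hy
    induction hy using Submodule.mul_induction_on' with
    | mem_mul_mem y hy z hz =>
      rw [rightAction_mul]
      exact rightAction_mem_altSpan (ih x trivial y hy) hz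
    | add y _ z _ hy hz =>
      rw [map_add]
      exact Submodule.add_mem _ hy hz

end Generators

/-! ### The comparison map -/

section Comparison

variable {X : Type u} [TopologicalSpace X] {a b : X}

/-- The class `[γ^{(n)}]` as a function of the homotopy class of `γ`. -/
noncomputable def homotopyPathClass (n : ℕ) (γ : Path.Homotopic.Quotient a b) :
    RelHomology n (diagSet n a b) :=
  Quotient.lift (s := Path.Homotopic.setoid a b) (pathClass n)
    (fun _ _ h => Nonempty.elim h (pathClass_eq_of_homotopy n)) γ

/-- The map `ℤπ₁(a,b) → H_n(X^n, Y_{ab}^{(n)})` that sends the class of `γ` to `[γ^{(n)}]`. -/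
noncomputable def pathModuleClass (n : ℕ) (a b : X) :
    PathModule a b →ₗ[ℤ] RelHomology n (diagSet n a b) :=
  Finsupp.linearCombination ℤ (homotopyPathClass n)

theorem pathModuleClass_single (n : ℕ) (γ : Path a b) :
    pathModuleClass n a b (Finsupp.single (Path.Homotopic.Quotient.mk γ) 1) = pathClass n γ := by
  rw [pathModuleClass, Finsupp.linearCombination_single, one_smul]
  rfl

/-- The exponent `n + 1` enters as the number of loops, one more than the number of coordinates of
`X^n`. -/
theorem augSubmodule_le_ker (n : ℕ) (a b : X) :
    augSubmodule (n + 1) a b ≤ LinearMap.ker (pathModuleClass n a b) := by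
  refine (augSubmodule_le_altSpan (n + 1) a b).trans (Submodule.span_le.2 ?_)
  rintro _ ⟨γ, α, rfl⟩
  rw [SetLike.mem_coe, LinearMap.mem_ker, altSum, map_sum]
  simp only [map_smul, pathModuleClass_single]
  exact sum_loopProduct_pathClass_eq_zero γ α

/-- The map `F_n(X,a,b) → H_n(X^n, Y_{ab}^{(n)})` that sends the class of `γ` to `[γ^{(n)}]`. -/
noncomputable def comparison (n : ℕ) (a b : X) :
    FQuot n a b →ₗ[ℤ] RelHomology n (diagSet n a b) :=
  (augSubmodule (n + 1) a b).liftQ (pathModuleClass n a b) (augSubmodule_le_ker n a b)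

theorem comparison_pathGen (n : ℕ) (γ : Path a b) :
    comparison n a b (pathGen n γ) = pathClass n γ :=
  pathModuleClass_single n γ

/-- The classes of paths generate the quotient; both uniqueness and naturality rest on this. -/
theorem FQuot_hom_ext {n : ℕ} {M : Type*} [AddCommGroup M] {φ ψ : FQuot n a b →+ M}
    (h : ∀ γ : Path a b, φ (pathGen n γ) = ψ (pathGen n γ)) : φ = ψ := by
  ext x
  obtain ⟨x, rfl⟩ := Submodule.mkQ_surjective _ x
  induction x using Finsupp.induction_linear with
  | zero => rw [map_zero, map_zero, map_zero]
  | add x y hx hy => rw [map_add, map_add, map_add, hx, hy]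
  | single γ c =>
    obtain ⟨γ, rfl⟩ := Path.Homotopic.Quotient.mk_surjective γ
    rw [← mul_one c, ← smul_eq_mul, ← Finsupp.smul_single, map_smul, map_zsmul, map_zsmul]
    exact congrArg (c • ·) (h γ)

theorem FQuotMap_pathGen {X X' : Top₂.{u}} (n : ℕ) (f : X ⟶ X') (γ : Path X.a X.b) :
    FQuotMap n f (pathGen n γ) =
      pathGen n ((γ.map f.map.continuous).cast f.map_a.symm f.map_b.symm) := by
  refine congrArg (Submodule.Quotient.mk (p := _)) ?_
  rw [pathModuleMap, Finsupp.lmapDomain_apply, Finsupp.mapDomain_single]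
  rfl

theorem relHomologyMap_pathClass {X X' : Top₂.{u}} (n : ℕ) (f : X ⟶ X') (γ : Path X.a X.b) :
    relHomologyMap n (powMap n f.map) (powMap_mapsTo n f) (pathClass n γ) =
      pathClass n ((γ.map f.map.continuous).cast f.map_a.symm f.map_b.symm) := by
  refine congrArg (Submodule.Quotient.mk (p := _)) (Subtype.ext ?_)
  refine congrArg (Submodule.Quotient.mk (p := _)) ?_
  rw [chainMap_single]
  rfl

/-- The comparison map as a natural transformation `F_n ⟶ H_n`. -/
noncomputable def comparisonNatTrans (n : ℕ) : functorF.{u} n ⟶ functorH.{u} n where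
  app X := AddCommGrpCat.ofHom (comparison n X.a X.b).toAddMonoidHom
  naturality X X' f := by
    refine AddCommGrpCat.hom_ext (FQuot_hom_ext fun γ => ?_)
    change comparison n X'.a X'.b (FQuotMap n f (pathGen n γ)) =
      relHomologyMap n (powMap n f.map) (powMap_mapsTo n f) (comparison n X.a X.b (pathGen n γ))
    rw [FQuotMap_pathGen, comparison_pathGen, comparison_pathGen, relHomologyMap_pathClass]

end Comparison

end PathHomology

/-- For every `n ≥ 0` there is a natural transformation `ν : F_n ⟶ H_n` of functors from
bipointed spaces to abelian groups such that each component `ν_X` is the one and only morphism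
`F_n(X,a,b) → H_n(X^n, Y_{ab}^{(n)})` taking the class of every path `γ` to `[γ^{(n)}]`. -/
theorem mainTheorem2 (n : ℕ) :
    ∃ ν : functorF.{u} n ⟶ functorH.{u} n, ∀ X : Top₂.{u},
      (∀ γ : Path X.a X.b, (ν.app X).hom (pathGen n γ) = pathClass n γ) ∧
      ∀ φ : FQuot n X.a X.b →+ RelHomology n (diagSet n X.a X.b),
        (∀ γ : Path X.a X.b, φ (pathGen n γ) = pathClass n γ) → φ = (ν.app X).hom := by
  refine ⟨comparisonNatTrans n, fun X => ⟨comparison_pathGen n, fun φ hφ => ?_⟩⟩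
  exact FQuot_hom_ext fun γ => (hφ γ).trans (comparison_pathGen n γ).symm
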